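/- **Setting.** Let $P\in\mathbb N$, let $x^{[1]},\dots,x^{[P]}\in\mathbb R^3$, and let $\phi\in\mathcal S(\mathbb R)$ (real or complex valued). Let $\mathfrak H=\{V\in L^2(\mathbb R^3;\mathbb C^3): k\cdot V(k)=0 \text{ a.e.}\}$, let $\mathcal H_{\rm ph}$ be the symmetric Fock space over $\mathfrak H$ with vacuum $\Psi_0$, let $\mathcal H_{\rm sp}=(\mathbb C^2)^{\otimes P}$ and $\mathcal H_{\rm tot}=\mathcal H_{\rm ph}\otimes\mathcal H_{\rm sp}$. Let $H_{\rm ph}={\rm d}\Gamma(M_\omega)$, where $M_\omega$ is the multiplication by $|k|$, and let $\Phi_{\rm S}(V)=2^{-1/2}(a(V)+a^*(V))$ be the Segal field. With the Pauli matrices $\sigma_1,\sigma_2,\sigma_3$, let $\sigma_m^{[\lambda]}$ be $\sigma_m$ acting on the $\lambda$-th factor of $\mathcal H_{\rm sp}$. For $m=1,2,3$ and $x\in\mathbb R^3$, with the canonical basis $(e_1,e_2,e_3)$ of $\mathbb R^3$, put $$B_{m,x}(k)=\frac{i\,\phi(|k|)\,|k|^{1/2}}{(2\pi)^{3/2}}\,e^{-ik\cdot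 x}\,\frac{k\times e_m}{|k|}.$$ For $M=(M^{[1]},\dots,M^{[P]})\in\mathbb R^P$, with Euclidean norm $|M|$, put $$H_{\rm int}(M)=\sum_{\lambda=1}^P\sum_{m=1}^3M^{[\lambda]}\,\Phi_{\rm S}(B_{m,x^{[\lambda]}})\otimes\sigma_m^{[\lambda]},\qquad H(M)=H_{\rm ph}\otimes I+H_{\rm int}(M).$$ Let $D(H)=D(H_{\rm ph}\otimes I)$, with the norm $\|f\|_{D(H)}^2=\|(H_{\rm ph}\otimes I)f\|^2+\|f\|^2$. Let $EX=\Psi_0\otimes X$ for $X\in\mathcal H_{\rm sp}$, let $({\rm d}\Gamma(M_\omega))^{-1}$ be the inverse of ${\rm d}\Gamma(M_\omega)$ on the orthogonal complement of $\Psi_0$, and put $$u_M(X)=\big(({\rm d}\Gamma(M_\omega))^{-1}\otimes I\big)H_{\rm int}(M)EX,\qquad A_MX=-E^\star H_{\rm int}(M)\,u_M(X).$$ For $r\ge0$ let $B_r(X)=\{f\in D(H):\|f-\Psi_0\otimes X\|_{D(H)}\le r|X|\}$. **Proposition.** 1. For all $M\in\mathbb R^P$ and $X\in\mathcal H_{\rm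 sp}$, the domain of $H(M)$ (the intersection of the domains of its summands) is $D(H)$, and in the formula for $A_MX$ every operator is applied to an element of its domain. There is a $K>0$ such that $$\|u_M(X)\|_{D(H)}\le K\,|M|\,|X|\qquad\text{for all }M\in\mathbb R^P,\ X\in\mathcal H_{\rm sp}.\tag{1}$$ 2. There is a $C>0$, depending only on $P$, the $x^{[\lambda]}$ and $\phi$, such that for every $K>0$ with (1), every $\rho\ge K$, every $M\in\mathbb R^P$ with $|M|<1/\rho$ and every $X\in\mathcal H_{\rm sp}$, the infimum below is finite and $$\Big|\langle A_MX,X\rangle-\inf_{f\in B_{\rho|M|}(X)}\langle H(M)f,f\rangle\Big|\le C\rho^2|M|^3|X|^2.$$ 3. Consequently, for each fixed $X\in\mathcal H_{\rm sp}$, the function $M\mapsto\langle A_MX,X\rangle$ is a real quadratic form on $\mathbb R^P$, and for every $K>0$ with (1) and every $\rho\ge K$, as $M\to0$, $$\inf_{f\in B_{\rho|M|}(X)}\langle H(M)f,f\rangle=\langle A_MX,X\rangle+O(|M|^3).$$ That is, $\langle A_MX,X\rangle$ is the quadratic term of this constrained energy (there are no terms of order $0$ and $1$), and it does not depend on $\rho$.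 -/

import Mathlib

open MeasureTheory Filter Topology
open scoped ENNReal InnerProductSpace SchwartzMap Matrix

noncomputable section

namespace SpinPhoton

/-! ### The one-photon space -/

/-- Momentum (and position) space `ℝ³`. -/
abbrev R3 : Type := EuclideanSpace ℝ (Fin 3)

/-- `(ℂ³)^{⊗ n}`, the values of an `n`-photon wave function, as coordinate arrays. -/
abbrev Pol (n : ℕ) : Type := EuclideanSpace ℂ (Fin n → Fin 3)

/-- The one-photon space: the `V ∈ L²(ℝ³; ℂ³)` with `k · V(k) = 0` for almost every `k`. -/
def onePhoton : Submodule ℂ (Lp (EuclideanSpace ℂ (Fin 3)) 2 (volume : Measure R3)) where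
  carrier := {V | ∀ᵐ k : R3, ∑ j, (k j : ℂ) * V k j = 0}
  add_mem' := by
    intro V W hV hW
    filter_upwards [hV, hW, Lp.coeFn_add V W] with k h1 h2 h3
    rw [h3]
    simp only [Pi.add_apply, PiLp.add_apply, mul_add, Finset.sum_add_distrib, h1, h2, add_zero]
  zero_mem' := by
    filter_upwards [Lp.coeFn_zero (EuclideanSpace ℂ (Fin 3)) 2 (volume : Measure R3)] with k h
    rw [h]
    simp
  smul_mem' := by
    intro c V hV
    filter_upwards [hV, Lp.coeFn_smul c V] with k h1 h3
    have : ∀ j, (k j : ℂ) * (c * V k j) = c * ((k j : ℂ) * V k j) := fun j => by ring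
    rw [h3]
    simp only [Pi.smul_apply, PiLp.smul_apply, smul_eq_mul, this, ← Finset.mul_sum, h1, mul_zero]

/-! ### The symmetric Fock space of the photons -/

/-- `L²((ℝ³)ⁿ; (ℂ³)^{⊗ n}) = L²(ℝ³; ℂ³)^{⊗ n}`. -/
abbrev NL2 (n : ℕ) : Type := Lp (Pol n) 2 (volume : Measure (Fin n → R3))

/-- Pointwise conditions on an `n`-photon wave function: invariance under the simultaneous
permutation of momenta and polarization indices, and transversality in each variable. -/
structure IsPhotonFun {n : ℕ} (f : (Fin n → R3) → Pol n) : Prop where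
  symm : ∀ τ : Equiv.Perm (Fin n), ∀ᵐ k : Fin n → R3, ∀ a : Fin n → Fin 3,
    f (k ∘ τ) (a ∘ τ) = f k a
  transverse : ∀ᵐ k : Fin n → R3, ∀ (l : Fin n) (a : Fin n → Fin 3),
    ∑ j : Fin 3, (k l j : ℂ) * f k (Function.update a l j) = 0

lemma measurePreserving_perm {n : ℕ} (τ : Equiv.Perm (Fin n)) :
    MeasurePreserving (fun k : Fin n → R3 => k ∘ τ) volume volume := by
  have h := volume_measurePreserving_piCongrLeft (fun _ : Fin n => R3) τ.symm
  convert h using 1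
  funext k
  ext1 i
  simp [MeasurableEquiv.coe_piCongrLeft, Equiv.piCongrLeft_apply]

lemma IsPhotonFun.congr {n : ℕ} {f g : (Fin n → R3) → Pol n} (hf : IsPhotonFun f)
    (h : f =ᵐ[volume] g) : IsPhotonFun g where
  symm τ := by
    filter_upwards [hf.symm τ, h, (measurePreserving_perm τ).quasiMeasurePreserving.ae h]
      with k h1 h2 h3 a
    rw [← h2, ← h3, h1]
  transverse := by
    filter_upwards [hf.transverse, h] with k h1 h2 l a
    rw [← h2, h1]

/-- The `n`-photon space: the `n`-fold symmetric tensor power of the one-photon space. -/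
def nPhoton (n : ℕ) : Submodule ℂ (NL2 n) where
  carrier := {f | IsPhotonFun f}
  add_mem' := by
    intro f g hf hg
    refine IsPhotonFun.congr (f := fun k => f k + g k) ⟨fun τ => ?_, ?_⟩
      (Lp.coeFn_add f g).symm
    · filter_upwards [hf.symm τ, hg.symm τ] with k h1 h2 a
      simp [h1, h2]
    · filter_upwards [hf.transverse, hg.transverse] with k h1 h2 l a
      simp [mul_add, Finset.sum_add_distrib, h1, h2]
  zero_mem' := by
    refine IsPhotonFun.congr (f := fun k => 0) ⟨fun τ => ?_, ?_⟩ (Lp.coeFn_zero _ _ _).symm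
    · simp
    · simp
  smul_mem' := by
    intro c f hf
    refine IsPhotonFun.congr (f := fun k => c • f k) ⟨fun τ => ?_, ?_⟩
      (Lp.coeFn_smul c f).symm
    · filter_upwards [hf.symm τ] with k h1 a
      simp [h1]
    · filter_upwards [hf.transverse] with k h1 l a
      have : ∀ j, (k l j : ℂ) * (c * f k (Function.update a l j))
          = c * ((k l j : ℂ) * f k (Function.update a l j)) := fun j => by ring
      simp [this, ← Finset.mul_sum, h1]

lemma isClosed_nPhoton (n : ℕ) : IsClosed (nPhoton n : Set (NL2 n)) := by
  refine IsSeqClosed.isClosed fun u f hu hf => ?_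
  obtain ⟨ns, -, hae⟩ := (tendstoInMeasure_of_tendsto_Lp hf).exists_seq_tendsto_ae
  have hcoord : ∀ {k : Fin n → R3}, Tendsto (fun i => u (ns i) k) atTop (𝓝 (f k)) →
      ∀ a, Tendsto (fun i => u (ns i) k a) atTop (𝓝 (f k a)) := by
    intro k hk a
    exact ((EuclideanSpace.proj (𝕜 := ℂ) a).continuous.tendsto _).comp hk
  constructor
  · intro τ
    have h1 : ∀ᵐ k : Fin n → R3, ∀ i, ∀ a, u (ns i) (k ∘ τ) (a ∘ τ) = u (ns i) k a :=
      ae_all_iff.2 fun i => (hu (ns i)).symm τ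
    filter_upwards [h1, hae, (measurePreserving_perm τ).quasiMeasurePreserving.ae hae]
      with k h1 h2 h3 a
    refine tendsto_nhds_unique (hcoord h3 (a ∘ τ)) ?_
    simpa only [h1] using hcoord h2 a
  · have h1 : ∀ᵐ k : Fin n → R3, ∀ i, ∀ l a,
        ∑ j : Fin 3, (k l j : ℂ) * u (ns i) k (Function.update a l j) = 0 :=
      ae_all_iff.2 fun i => (hu (ns i)).transverse
    filter_upwards [h1, hae] with k h1 h2 l a
    have h3 := tendsto_finsetSum (Finset.univ : Finset (Fin 3)) fun j _ =>
      (hcoord h2 (Function.update a l j)).const_mul (k l j : ℂ)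
    simp only [h1] at h3
    exact (tendsto_nhds_unique h3 tendsto_const_nhds)

instance (n : ℕ) : CompleteSpace (nPhoton n) := (isClosed_nPhoton n).completeSpace_coe

/-- The photon Hilbert space: the Hilbert sum of the `n`-photon spaces. -/
abbrev Fock : Type := lp (fun n : ℕ => nPhoton n) 2

/-- The vacuum vector of the zero-photon space `≅ ℂ`: the constant function `1`. -/
def vacuumZero : nPhoton 0 :=
  ⟨MemLp.toLp (fun _ : Fin 0 → R3 => (WithLp.toLp 2 (fun _ => 1) : Pol 0))
      (by
        have : IsFiniteMeasure (volume : Measure (Fin 0 → R3)) := by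
          rw [volume_pi, Measure.pi_of_empty]; infer_instance
        exact memLp_const _),
    IsPhotonFun.congr ⟨fun τ => by simp, by simp⟩ (MemLp.coeFn_toLp _).symm⟩

/-- The photon vacuum `Ψ₀`. -/
def vacuum : Fock := lp.single 2 0 vacuumZero

/-! ### Second quantized multiplication by `|k|` -/

/-- The graph of `dΓ(M_ω)`, `ω(k) = |k|`: on the `n`-photon space it is the multiplication by
`|k₁| + ⋯ + |kₙ|`, on its maximal domain. -/
def photonEnergyGraph : Submodule ℂ (Fock × Fock) where
  carrier := {p | ∀ n, ∀ᵐ k : Fin n → R3,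
    (p.2 n : NL2 n) k = ((∑ l, ‖k l‖ : ℝ) : ℂ) • (p.1 n : NL2 n) k}
  add_mem' := by
    intro p q hp hq n
    filter_upwards [hp n, hq n, Lp.coeFn_add (p.1 n : NL2 n) (q.1 n : NL2 n),
      Lp.coeFn_add (p.2 n : NL2 n) (q.2 n : NL2 n)] with k h1 h2 h3 h4
    simp only [Pi.add_apply] at h3 h4
    simp only [Prod.snd_add, Prod.fst_add, lp.coeFn_add, Pi.add_apply, Submodule.coe_add]
    rw [h3, h4, h1, h2, smul_add]
  zero_mem' := by
    intro n
    filter_upwards [Lp.coeFn_zero (Pol n) 2 (volume : Measure (Fin n → R3))] with k h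
    simp only [Prod.snd_zero, Prod.fst_zero, lp.coeFn_zero, Pi.zero_apply, Submodule.coe_zero, h,
      smul_zero]
  smul_mem' := by
    intro c p hp n
    filter_upwards [hp n, Lp.coeFn_smul c (p.1 n : NL2 n), Lp.coeFn_smul c (p.2 n : NL2 n)]
      with k h1 h3 h4
    simp only [Pi.smul_apply] at h3 h4
    simp only [Prod.smul_snd, Prod.smul_fst, lp.coeFn_smul, Pi.smul_apply, Submodule.coe_smul]
    rw [h3, h4, h1, smul_comm]

/-- `H_ph = dΓ(M_ω)`, a self-adjoint operator in the Fock space. -/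
def photonEnergy : Fock →ₗ.[ℂ] Fock := photonEnergyGraph.toLinearPMap

/-- `(dΓ(M_ω))⁻¹`: the inverse of the restriction of `dΓ(M_ω)` to the orthogonal complement of
its kernel `ℂ Ψ₀`. -/
def photonEnergyInv : Fock →ₗ.[ℂ] Fock := (photonEnergy.domRestrict (ℂ ∙ vacuum)ᗮ).inverse

/-! ### Creation operators and Segal fields -/

/-- Tensoring `f` with `V`, the new photon being put in position `l`. -/
def insertFun {n : ℕ} (l : Fin (n + 1)) (V : R3 → EuclideanSpace ℂ (Fin 3))
    (f : (Fin n → R3) → Pol n) (k : Fin (n + 1) → R3) : Pol (n + 1) :=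
  WithLp.toLp 2 fun a =>
    V (k l) (a l) * f (fun i => k (l.succAbove i)) (fun i => a (l.succAbove i))

lemma norm_insertFun {n : ℕ} (l : Fin (n + 1)) (V : R3 → EuclideanSpace ℂ (Fin 3))
    (f : (Fin n → R3) → Pol n) (k : Fin (n + 1) → R3) :
    ‖insertFun l V f k‖ = ‖V (k l)‖ * ‖f (fun i => k (l.succAbove i))‖ := by
  rw [EuclideanSpace.norm_eq, EuclideanSpace.norm_eq, EuclideanSpace.norm_eq,
    ← Real.sqrt_mul (by positivity), Finset.sum_mul_sum, ← Finset.sum_product',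
    Finset.univ_product_univ]
  congr 1
  refine Fintype.sum_equiv (Fin.insertNthEquiv (fun _ => Fin 3) l).symm _ _ fun a => ?_
  simp only [insertFun, norm_mul, mul_pow]
  rfl

lemma measurePreserving_split {n : ℕ} (l : Fin (n + 1)) :
    MeasurePreserving (fun k : Fin (n + 1) → R3 => (k l, fun i => k (l.succAbove i)))
      volume (volume.prod volume) :=
  volume_preserving_piFinSuccAbove (fun _ : Fin (n + 1) => R3) l

lemma quasi_fst {n : ℕ} (l : Fin (n + 1)) :
    Measure.QuasiMeasurePreserving (fun k : Fin (n + 1) → R3 => k l) volume volume :=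
  Measure.quasiMeasurePreserving_fst.comp (measurePreserving_split l).quasiMeasurePreserving

lemma quasi_snd {n : ℕ} (l : Fin (n + 1)) :
    Measure.QuasiMeasurePreserving
      (fun (k : Fin (n + 1) → R3) (i : Fin n) => k (l.succAbove i)) volume volume :=
  Measure.quasiMeasurePreserving_snd.comp (measurePreserving_split l).quasiMeasurePreserving

lemma insertFun_congr {n : ℕ} (l : Fin (n + 1)) {V V' : R3 → EuclideanSpace ℂ (Fin 3)}
    {f f' : (Fin n → R3) → Pol n} (hV : V =ᵐ[volume] V') (hf : f =ᵐ[volume] f') :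
    insertFun l V f =ᵐ[volume] insertFun l V' f' := by
  filter_upwards [(quasi_fst l).ae hV, (quasi_snd l).ae hf] with k h1 h2
  simp only [insertFun, h1, h2]

lemma aestronglyMeasurable_insertFun {n : ℕ} (l : Fin (n + 1))
    {V : R3 → EuclideanSpace ℂ (Fin 3)} {f : (Fin n → R3) → Pol n}
    (hV : AEStronglyMeasurable V volume) (hf : AEStronglyMeasurable f volume) :
    AEStronglyMeasurable (insertFun l V f) volume := by
  have hc : Continuous fun p : EuclideanSpace ℂ (Fin 3) × Pol n =>
      (WithLp.toLp 2 (fun a : Fin (n + 1) → Fin 3 =>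
        p.1 (a l) * p.2 (fun i => a (l.succAbove i))) : Pol (n + 1)) := by
    fun_prop
  exact hc.comp_aestronglyMeasurable
    ((hV.comp_quasiMeasurePreserving (quasi_fst l)).prodMk
      (hf.comp_quasiMeasurePreserving (quasi_snd l)))

lemma eLpNorm_insertFun {n : ℕ} (l : Fin (n + 1))
    {V : R3 → EuclideanSpace ℂ (Fin 3)} {f : (Fin n → R3) → Pol n}
    (hV : AEStronglyMeasurable V volume) (hf : AEStronglyMeasurable f volume) :
    eLpNorm (insertFun l V f) 2 volume = eLpNorm V 2 volume * eLpNorm f 2 volume := by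
  have h2 : (2 : ℝ≥0∞) ≠ 0 := by norm_num
  have h2' : (2 : ℝ≥0∞) ≠ ∞ := by norm_num
  rw [eLpNorm_eq_lintegral_rpow_enorm_toReal h2 h2', eLpNorm_eq_lintegral_rpow_enorm_toReal h2 h2',
    eLpNorm_eq_lintegral_rpow_enorm_toReal h2 h2', ← ENNReal.mul_rpow_of_nonneg _ _ (by simp)]
  congr 1
  have e : ∀ k, ‖insertFun l V f k‖ₑ ^ (2 : ℝ≥0∞).toReal
      = (fun p : R3 × (Fin n → R3) =>
          ‖V p.1‖ₑ ^ (2 : ℝ≥0∞).toReal * ‖f p.2‖ₑ ^ (2 : ℝ≥0∞).toReal)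
        (k l, fun i => k (l.succAbove i)) := by
    intro k
    have : ‖insertFun l V f k‖ₑ = ‖V (k l)‖ₑ * ‖f (fun i => k (l.succAbove i))‖ₑ := by
      rw [← ofReal_norm, norm_insertFun, ENNReal.ofReal_mul (norm_nonneg _), ofReal_norm,
        ofReal_norm]
    rw [this, ENNReal.mul_rpow_of_nonneg _ _ (by simp)]
  simp_rw [e]
  rw [← lintegral_prod_mul (hV.enorm.pow_const _) (hf.enorm.pow_const _),
    ← (measurePreserving_split l).map_eq]
  refine (lintegral_map' (f := fun p : R3 × (Fin n → R3) =>
      ‖V p.1‖ₑ ^ (2 : ℝ≥0∞).toReal * ‖f p.2‖ₑ ^ (2 : ℝ≥0∞).toReal) ?_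
    (measurePreserving_split l).measurable.aemeasurable).symm
  rw [(measurePreserving_split l).map_eq]
  exact ((hV.enorm.pow_const _).comp_quasiMeasurePreserving
      Measure.quasiMeasurePreserving_fst).mul
    ((hf.enorm.pow_const _).comp_quasiMeasurePreserving Measure.quasiMeasurePreserving_snd)

lemma memLp_insertFun {n : ℕ} (l : Fin (n + 1))
    {V : R3 → EuclideanSpace ℂ (Fin 3)} {f : (Fin n → R3) → Pol n}
    (hV : MemLp V 2 volume) (hf : MemLp f 2 volume) :
    MemLp (insertFun l V f) 2 volume :=
  ⟨aestronglyMeasurable_insertFun l hV.1 hf.1, by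
    rw [eLpNorm_insertFun l hV.1 hf.1]; exact ENNReal.mul_lt_top hV.2 hf.2⟩

/-- `insertFun` as a bounded operator. -/
def insertL (n : ℕ) (V : Lp (EuclideanSpace ℂ (Fin 3)) 2 (volume : Measure R3))
    (l : Fin (n + 1)) : NL2 n →L[ℂ] NL2 (n + 1) :=
  LinearMap.mkContinuous
    { toFun := fun f => (memLp_insertFun l (Lp.memLp V) (Lp.memLp f)).toLp _
      map_add' := by
        intro f g
        apply Lp.ext
        filter_upwards [MemLp.coeFn_toLp (memLp_insertFun l (Lp.memLp V) (Lp.memLp (f + g))),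
          MemLp.coeFn_toLp (memLp_insertFun l (Lp.memLp V) (Lp.memLp f)),
          MemLp.coeFn_toLp (memLp_insertFun l (Lp.memLp V) (Lp.memLp g)),
          Lp.coeFn_add ((memLp_insertFun l (Lp.memLp V) (Lp.memLp f)).toLp _)
            ((memLp_insertFun l (Lp.memLp V) (Lp.memLp g)).toLp _),
          insertFun_congr l (ae_eq_refl V) (Lp.coeFn_add f g)] with k h1 h2 h3 h4 h5
        rw [h1, h4, Pi.add_apply, h2, h3, h5]
        ext a
        simp [insertFun, mul_add]
      map_smul' := by
        intro c f
        apply Lp.ext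
        filter_upwards [MemLp.coeFn_toLp (memLp_insertFun l (Lp.memLp V) (Lp.memLp (c • f))),
          MemLp.coeFn_toLp (memLp_insertFun l (Lp.memLp V) (Lp.memLp f)),
          Lp.coeFn_smul c ((memLp_insertFun l (Lp.memLp V) (Lp.memLp f)).toLp _),
          insertFun_congr l (ae_eq_refl V) (Lp.coeFn_smul c f)] with k h1 h2 h4 h5
        rw [h1, RingHom.id_apply, h4, Pi.smul_apply, h2, h5]
        ext a
        simp [insertFun, mul_left_comm] }
    ‖V‖ (fun f => by
      simp only [LinearMap.coe_mk, AddHom.coe_mk]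
      rw [Lp.norm_toLp, eLpNorm_insertFun l (Lp.memLp V).1 (Lp.memLp f).1, ENNReal.toReal_mul,
        Lp.norm_def, Lp.norm_def])

lemma coeFn_insertL (n : ℕ) (V : Lp (EuclideanSpace ℂ (Fin 3)) 2 (volume : Measure R3))
    (l : Fin (n + 1)) (f : NL2 n) : insertL n V l f =ᵐ[volume] insertFun l V f :=
  MemLp.coeFn_toLp (memLp_insertFun l (Lp.memLp V) (Lp.memLp f))

lemma exists_perm_succAbove {n : ℕ} (σ : Equiv.Perm (Fin (n + 1))) (l : Fin (n + 1)) :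
    ∃ τ : Equiv.Perm (Fin n), ∀ i, σ (l.succAbove i) = (σ l).succAbove (τ i) := by
  have h : ∀ i, ∃ j, (σ l).succAbove j = σ (l.succAbove i) := fun i =>
    Fin.exists_succAbove_eq (fun h => Fin.succAbove_ne l i (σ.injective h))
  choose t ht using h
  have hinj : Function.Injective t := by
    intro i j hij
    have : σ (l.succAbove i) = σ (l.succAbove j) := by rw [← ht, ← ht, hij]
    exact Fin.succAbove_right_injective (σ.injective this)
  exact ⟨Equiv.ofBijective t (Finite.injective_iff_bijective.1 hinj), fun i => (ht i).symm⟩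

lemma sum_insertFun_isPhotonFun {n : ℕ} {V : R3 → EuclideanSpace ℂ (Fin 3)}
    {f : (Fin n → R3) → Pol n} (hV : ∀ᵐ k : R3, ∑ j, (k j : ℂ) * V k j = 0)
    (hf : IsPhotonFun f) :
    IsPhotonFun fun k => ∑ l, insertFun l V f k := by
  constructor
  · intro σ
    choose τ hτ using exists_perm_succAbove σ
    have h1 : ∀ᵐ k : Fin (n + 1) → R3, ∀ l, ∀ a : Fin n → Fin 3,
        f ((fun i => k ((σ l).succAbove i)) ∘ τ l) (a ∘ τ l)
          = f (fun i => k ((σ l).succAbove i)) a :=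
      ae_all_iff.2 fun l => (quasi_snd (σ l)).ae (hf.symm (τ l))
    filter_upwards [h1] with k h1 a
    simp only [WithLp.ofLp_sum, Finset.sum_apply]
    refine Fintype.sum_equiv σ _ _ fun l => ?_
    have h2 := h1 l (fun i => a ((σ l).succAbove i))
    simp only [insertFun, Function.comp_def, hτ] at h2 ⊢
    rw [h2]
  · have h1 : ∀ᵐ k : Fin (n + 1) → R3, ∀ l, ∑ j, (k l j : ℂ) * V (k l) j = 0 :=
      ae_all_iff.2 fun l => (quasi_fst l).ae hV
    have h2 : ∀ᵐ k : Fin (n + 1) → R3, ∀ (l : Fin (n + 1)) (q : Fin n) (a : Fin n → Fin 3),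
        ∑ j : Fin 3, (k (l.succAbove q) j : ℂ)
          * f (fun i => k (l.succAbove i)) (Function.update a q j) = 0 :=
      ae_all_iff.2 fun l => (quasi_snd l).ae hf.transverse
    filter_upwards [h1, h2] with k h1 h2 p a
    simp only [WithLp.ofLp_sum, Finset.sum_apply, Finset.mul_sum]
    rw [Finset.sum_comm]
    refine Finset.sum_eq_zero fun l _ => ?_
    simp only [insertFun]
    rcases eq_or_ne p l with rfl | hpl
    · have : ∀ j : Fin 3, (fun i => Function.update a p j (p.succAbove i))
          = fun i => a (p.succAbove i) := fun j => by
        funext i; rw [Function.update_of_ne (Fin.succAbove_ne p i)]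
      simp only [this, Function.update_self, ← mul_assoc, ← Finset.sum_mul, h1, zero_mul]
    · obtain ⟨q, rfl⟩ := Fin.exists_succAbove_eq hpl
      have e1 : ∀ j : Fin 3, (fun i => Function.update a (l.succAbove q) j (l.succAbove i))
          = Function.update (fun i => a (l.succAbove i)) q j := fun j => by
        funext i
        rcases eq_or_ne i q with rfl | hi
        · simp
        · rw [Function.update_of_ne hi, Function.update_of_ne
            (fun h => hi (Fin.succAbove_right_injective h))]
      have e2 : ∀ j : Fin 3, Function.update a (l.succAbove q) j l = a l := fun j =>
        Function.update_of_ne hpl.symm _ _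
      simp only [e1, e2, mul_left_comm _ (V (k l) (a l)), ← Finset.mul_sum, h2, mul_zero]

/-- The creation operator `a*(V)` from `n` to `n + 1` photons:
`(a*(V) f)(k₀, …, kₙ) = (n + 1)^{-1/2} ∑ₗ V(kₗ) ⊗ f(k₀, …, k̂ₗ, …, kₙ)`. -/
def creation (V : onePhoton) (n : ℕ) : nPhoton n →L[ℂ] nPhoton (n + 1) :=
  (((((Real.sqrt (n + 1))⁻¹ : ℝ) : ℂ) • ∑ l, insertL n V l) ∘L (nPhoton n).subtypeL).codRestrict
    (nPhoton (n + 1)) (by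
      intro f
      refine (nPhoton (n + 1)).smul_mem _ ?_
      refine IsPhotonFun.congr (sum_insertFun_isPhotonFun V.2 f.2) ?_
      simp only [ContinuousLinearMap.coe_coe, Submodule.subtypeL_apply,
        _root_.sum_apply]
      have h1 : ∀ᵐ k, ∀ l, insertL n V l f k = insertFun l V (f : NL2 n) k :=
        ae_all_iff.2 fun l => coeFn_insertL n V l f
      have h2 := Lp.coeFn_finsetSum (p := 2) (μ := (volume : Measure (Fin (n + 1) → R3)))
        Finset.univ (fun l => insertL n V l (f : NL2 n))
      filter_upwards [h1, h2] with k h1 h2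
      rw [h2, Finset.sum_apply]
      exact Finset.sum_congr rfl fun l _ => (h1 l).symm)

/-- The `n`-photon component of `a*(V) f`. -/
def creationPart (V : onePhoton) : (n : ℕ) → Fock →ₗ[ℂ] nPhoton n
  | 0 => 0
  | n + 1 => (creation V n).toLinearMap ∘ₗ
      { toFun := fun f => f n, map_add' := fun _ _ => rfl, map_smul' := fun _ _ => rfl }

/-- The `n`-photon component of `a(V) f`; on `n + 1` photons the annihilation operator is the
adjoint of the creation operator. -/
def annihilationPart (V : onePhoton) (n : ℕ) : Fock →ₗ[ℂ] nPhoton n :=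
  (ContinuousLinearMap.adjoint (creation V n)).toLinearMap ∘ₗ
    { toFun := fun f => f (n + 1), map_add' := fun _ _ => rfl, map_smul' := fun _ _ => rfl }

/-- The graph of the Segal field `Φ_S(V) = 2^{-1/2} (a(V) + a*(V))`, on its maximal domain: the
`f` in the Fock space for which `2^{-1/2} (a(V) f + a*(V) f)` is in the Fock space. -/
def segalGraph (V : onePhoton) : Submodule ℂ (Fock × Fock) where
  carrier := {p | ∀ n, p.2 n =
    (((Real.sqrt 2)⁻¹ : ℝ) : ℂ) • (annihilationPart V n p.1 + creationPart V n p.1)}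
  add_mem' := by
    intro p q hp hq n
    simp only [Prod.snd_add, Prod.fst_add, lp.coeFn_add, Pi.add_apply, map_add, hp n, hq n,
      smul_add]
    abel
  zero_mem' := by
    intro n
    simp
  smul_mem' := by
    intro c p hp n
    simp only [Prod.smul_snd, Prod.smul_fst, lp.coeFn_smul, Pi.smul_apply, map_smul, hp n,
      ← smul_add]
    rw [smul_comm]

/-- The Segal field operator `Φ_S(V)`. -/
def segalField (V : onePhoton) : Fock →ₗ.[ℂ] Fock := (segalGraph V).toLinearPMap

/-! ### Spins -/

/-- The spin space `(ℂ²)^{⊗ P}`, with the product basis labelled by `Fin P → Fin 2`. -/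
abbrev Hsp (P : ℕ) : Type := EuclideanSpace ℂ (Fin P → Fin 2)

/-- The Pauli matrices `σ₁, σ₂, σ₃`. -/
def pauli : Fin 3 → Matrix (Fin 2) (Fin 2) ℂ :=
  ![!![0, 1; 1, 0], !![0, -Complex.I; Complex.I, 0], !![1, 0; 0, -1]]

/-- `σ_m^{[lam]} = I ⊗ ⋯ ⊗ σ_m ⊗ ⋯ ⊗ I`, with `σ_m` in position `lam`. -/
def spinMatrix {P : ℕ} (m : Fin 3) (lam : Fin P) :
    Matrix (Fin P → Fin 2) (Fin P → Fin 2) ℂ :=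
  Matrix.of fun s t => ∏ μ, (if μ = lam then pauli m else 1) (s μ) (t μ)

/-- `H_ph ⊗ H_sp`: an element is given by its components, in `H_ph`, along the orthonormal product
basis of the finite dimensional space `H_sp`. -/
abbrev Htot (P : ℕ) : Type := PiLp 2 (fun _ : Fin P → Fin 2 => Fock)

/-- The operator `T ⊗ S`, with domain `D(T) ⊗ H_sp`. -/
def opTensor {P : ℕ} (T : Fock →ₗ.[ℂ] Fock) (S : Matrix (Fin P → Fin 2) (Fin P → Fin 2) ℂ) :
    Htot P →ₗ.[ℂ] Htot P where
  domain :=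
    { carrier := {f | ∀ s, f s ∈ T.domain}
      add_mem' := fun hf hg s => T.domain.add_mem (hf s) (hg s)
      zero_mem' := fun _ => T.domain.zero_mem
      smul_mem' := fun c _ hf s => T.domain.smul_mem c (hf s) }
  toFun :=
    { toFun := fun f => WithLp.toLp 2 fun s => ∑ t, S s t • T ⟨f.1 t, f.2 t⟩
      map_add' := by
        intro f g
        ext1 s
        simp only [PiLp.add_apply, ← Finset.sum_add_distrib, ← smul_add, ← T.map_add]
        rfl
      map_smul' := by
        intro c f
        ext1 s
        simp only [PiLp.smul_apply, RingHom.id_apply, Finset.smul_sum, smul_comm c, ← T.map_smul]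
        rfl }

/-- `E X = Ψ₀ ⊗ X`. -/
def vacuumEmbedding (P : ℕ) : Hsp P →L[ℂ] Htot P :=
  LinearMap.toContinuousLinearMap
    { toFun := fun X => WithLp.toLp 2 fun s => X s • vacuum
      map_add' := by
        intro X Y
        ext1 s
        simp [add_smul]
      map_smul' := by
        intro c X
        ext1 s
        simp [mul_smul] }

/-! ### The interaction -/

/-- `B_{m,x}(k) = i φ(|k|) |k|^{1/2} (2π)^{-3/2} e^{-i k·x} (k × e_m) / |k|`. -/
def BFun (φ : 𝓢(ℝ, ℂ)) (m : Fin 3) (x : R3) (k : R3) : EuclideanSpace ℂ (Fin 3) :=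
  WithLp.toLp 2 fun j =>
    Complex.I * φ ‖k‖ * ((‖k‖ ^ (1 / 2 : ℝ) / (2 * Real.pi) ^ (3 / 2 : ℝ) : ℝ) : ℂ)
      * Complex.exp (-(Complex.I * ((inner ℝ k x : ℝ) : ℂ)))
      * ((((k : Fin 3 → ℝ) ⨯₃ Pi.single m 1) j / ‖k‖ : ℝ) : ℂ)

lemma norm_BFun_le (φ : 𝓢(ℝ, ℂ)) (m : Fin 3) (x : R3) :
    ∃ C : ℝ, ∀ k, ‖BFun φ m x k‖ ≤ C * (1 + ‖k‖) ^ (-2 : ℝ) := by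
  obtain ⟨D, hD⟩ : ∃ D : ℝ, ∀ r : ℝ, (1 + ‖r‖) ^ 3 * ‖φ r‖ ≤ D :=
    ⟨_, fun r => by
      simpa using SchwartzMap.one_add_le_sup_seminorm_apply (𝕜 := ℝ) (m := (3, 0)) (k := 3)
        (n := 0) le_rfl le_rfl φ r⟩
  refine ⟨2 * D, fun k => ?_⟩
  set r : ℝ := ‖k‖ with hr
  have hr0 : 0 ≤ r := norm_nonneg k
  have hb : ∀ j, ‖BFun φ m x k j‖ ≤ D * (1 + r) ^ (-2 : ℝ) := by
    intro j
    have h1 : ‖Complex.exp (-(Complex.I * ((inner ℝ k x : ℝ) : ℂ)))‖ = 1 := by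
      rw [← mul_neg, mul_comm, ← Complex.ofReal_neg, Complex.norm_exp_ofReal_mul_I]
    have h2 : |((k : Fin 3 → ℝ) ⨯₃ Pi.single m 1) j / r| ≤ 1 := by
      rw [abs_div, abs_of_nonneg hr0]
      refine div_le_one_of_le₀ ?_ hr0
      have hk : ∀ i, |k i| ≤ r := fun i => by simpa using PiLp.norm_apply_le k i
      fin_cases m <;> fin_cases j <;> simp [cross_apply, hk, hr0]
    have h3 : |r ^ (1 / 2 : ℝ) / (2 * Real.pi) ^ (3 / 2 : ℝ)| ≤ 1 + r := by
      rw [abs_of_nonneg (by positivity)]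
      have h4 : (1 : ℝ) ≤ (2 * Real.pi) ^ (3 / 2 : ℝ) :=
        Real.one_le_rpow (by nlinarith [Real.pi_gt_three]) (by norm_num)
      refine (div_le_self (by positivity) h4).trans ?_
      rw [← Real.sqrt_eq_rpow]
      exact Real.sqrt_le_iff.2 ⟨by positivity, by nlinarith⟩
    have h5 : ‖BFun φ m x k j‖ ≤ ‖φ r‖ * (1 + r) := by
      simp only [BFun, norm_mul, Complex.norm_I, one_mul, h1, mul_one, Complex.norm_real,
        Real.norm_eq_abs, ← hr]
      calc _ ≤ ‖φ r‖ * (1 + r) * 1 := by gcongr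
        _ = _ := mul_one _
    have h6 := hD r
    rw [Real.norm_of_nonneg hr0] at h6
    refine h5.trans ?_
    rw [Real.rpow_neg (by positivity), ← div_eq_mul_inv, le_div_iff₀ (by positivity)]
    calc ‖φ r‖ * (1 + r) * (1 + r) ^ (2 : ℝ) = (1 + r) ^ 3 * ‖φ r‖ := by
          rw [Real.rpow_ofNat]; ring
      _ ≤ D := h6
  set b := D * (1 + r) ^ (-2 : ℝ) with hbdef
  have hb0 : 0 ≤ b := (norm_nonneg _).trans (hb 0)
  rw [EuclideanSpace.norm_eq, mul_assoc, ← hbdef]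
  refine Real.sqrt_le_iff.2 ⟨by positivity, ?_⟩
  have h7 : ∀ j, ‖BFun φ m x k j‖ ^ 2 ≤ b ^ 2 := fun j =>
    pow_le_pow_left₀ (norm_nonneg _) (hb j) 2
  rw [Fin.sum_univ_three]
  nlinarith [h7 0, h7 1, h7 2, sq_nonneg b]

lemma measurable_BFun (φ : 𝓢(ℝ, ℂ)) (m : Fin 3) (x : R3) : Measurable (BFun φ m x) := by
  have hφ : Measurable fun k : R3 => φ ‖k‖ := (φ.continuous.comp continuous_norm).measurable
  have hk : ∀ i, Measurable fun k : R3 => k i := fun i =>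
    (EuclideanSpace.proj (𝕜 := ℝ) i).continuous.measurable
  have hcross : ∀ j, Measurable fun k : R3 => ((k : Fin 3 → ℝ) ⨯₃ Pi.single m 1) j := by
    intro j
    simp only [cross_apply]
    fin_cases j <;> simp only [Fin.zero_eta, Fin.mk_one, Fin.reduceFinMk, Matrix.cons_val] <;>
      fun_prop
  have hin : Measurable fun k : R3 => (inner ℝ k x : ℝ) := by fun_prop
  refine (PiLp.continuous_toLp 2 _).measurable.comp (measurable_pi_lambda _ fun j => ?_)
  have h1 := hcross j
  fun_prop

lemma memLp_BFun (φ : 𝓢(ℝ, ℂ)) (m : Fin 3) (x : R3) : MemLp (BFun φ m x) 2 volume := by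
  obtain ⟨C, hC⟩ := norm_BFun_le φ m x
  have hm := (measurable_BFun φ m x).aestronglyMeasurable (μ := (volume : Measure R3))
  rw [memLp_two_iff_integrable_sq_norm hm]
  have h4 : Integrable (fun k : R3 => C ^ 2 * (1 + ‖k‖) ^ (-(4 : ℝ))) volume :=
    (integrable_one_add_norm (by simp; norm_num)).const_mul _
  refine h4.mono' (hm.norm.pow 2) (ae_of_all _ fun k => ?_)
  have h0 : (0 : ℝ) < 1 + ‖k‖ := by positivity
  have e : ((1 + ‖k‖) ^ (-2 : ℝ)) ^ 2 = (1 + ‖k‖) ^ (-(4 : ℝ)) := by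
    rw [← Real.rpow_natCast, ← Real.rpow_mul h0.le]; norm_num
  rw [Real.norm_of_nonneg (by positivity), ← e, ← mul_pow]
  exact pow_le_pow_left₀ (norm_nonneg _) (hC k) 2

/-- `B_{m,x}` as an element of the one-photon space. -/
def BField (φ : 𝓢(ℝ, ℂ)) (m : Fin 3) (x : R3) : onePhoton :=
  ⟨(memLp_BFun φ m x).toLp _, by
    show ∀ᵐ k : R3, _
    filter_upwards [(memLp_BFun φ m x).coeFn_toLp] with k hk
    rw [hk]
    have h := dot_self_cross (k : Fin 3 → ℝ) (Pi.single m 1)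
    have h' : ((∑ j, k j * ((k : Fin 3 → ℝ) ⨯₃ Pi.single m 1) j : ℝ) : ℂ) = 0 := by
      exact_mod_cast h
    set c := Complex.I * φ ‖k‖ * ((‖k‖ ^ (1 / 2 : ℝ) / (2 * Real.pi) ^ (3 / 2 : ℝ) : ℝ) : ℂ)
      * Complex.exp (-(Complex.I * ((inner ℝ k x : ℝ) : ℂ))) with hc
    calc _ = ∑ j, c * (((‖k‖ : ℝ) : ℂ)⁻¹ *
          ((k j * ((k : Fin 3 → ℝ) ⨯₃ Pi.single m 1) j : ℝ) : ℂ)) := by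
          refine Finset.sum_congr rfl fun j _ => ?_
          simp only [BFun, ← hc]
          push_cast
          ring
      _ = 0 := by
          rw [← Finset.mul_sum, ← Finset.mul_sum, ← Complex.ofReal_sum, h', mul_zero, mul_zero]⟩

variable {P : ℕ}

/-- `H_ph ⊗ I`. Its domain is the space `D(H)`. -/
def freeHamiltonian (P : ℕ) : Htot P →ₗ.[ℂ] Htot P := opTensor photonEnergy 1

/-- `H_int(M) = ∑_lam ∑_m M^{[lam]} Φ_S(B_{m, x^{[lam]}}) ⊗ σ_m^{[lam]}`. -/
def interaction (φ : 𝓢(ℝ, ℂ)) (x : Fin P → R3) (M : EuclideanSpace ℝ (Fin P)) :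
    Htot P →ₗ.[ℂ] Htot P :=
  ∑ lam, ∑ m, (M lam : ℂ) • opTensor (segalField (BField φ m (x lam))) (spinMatrix m lam)

/-- `H(M) = H_ph ⊗ I + H_int(M)`, on the intersection of the domains of all the summands. -/
def hamiltonian (φ : 𝓢(ℝ, ℂ)) (x : Fin P → R3) (M : EuclideanSpace ℝ (Fin P)) :
    Htot P →ₗ.[ℂ] Htot P :=
  freeHamiltonian P + interaction φ x M

/-- The norm of `D(H)`: `‖f‖² = ‖(H_ph ⊗ I) f‖² + ‖f‖²`. -/
def domainNorm (f : (freeHamiltonian P).domain) : ℝ :=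
  Real.sqrt (‖freeHamiltonian P f‖ ^ 2 + ‖(f : Htot P)‖ ^ 2)

/-- The set of the `f` in `D(H)` whose `D(H)`-distance to `Ψ₀ ⊗ X` is at most `r |X|`. -/
def domainBall (r : ℝ) (X : Hsp P) : Set (Htot P) :=
  {f | f ∈ (freeHamiltonian P).domain ∧
    ∃ h : f - vacuumEmbedding P X ∈ (freeHamiltonian P).domain, domainNorm ⟨_, h⟩ ≤ r * ‖X‖}

/-- The energies `⟨H(M) f, f⟩` of the `f` in the ball of radius `r |X|` around `Ψ₀ ⊗ X`. -/
def ballEnergies (φ : 𝓢(ℝ, ℂ)) (x : Fin P → R3) (M : EuclideanSpace ℝ (Fin P)) (r : ℝ)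
    (X : Hsp P) : Set ℝ :=
  {e | ∃ f : (hamiltonian φ x M).domain, (f : Htot P) ∈ domainBall r X ∧
    e = (inner ℂ (hamiltonian φ x M f) (f : Htot P)).re}

/-- The infimum of `⟨H(M) f, f⟩` over the ball of radius `r |X|` around `Ψ₀ ⊗ X`. -/
def infEnergy (φ : 𝓢(ℝ, ℂ)) (x : Fin P → R3) (M : EuclideanSpace ℝ (Fin P)) (r : ℝ)
    (X : Hsp P) : ℝ :=
  sInf (ballEnergies φ x M r X)

open Classical in
/-- The value of an unbounded operator, with the value `0` outside of its domain. -/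
def value (T : Htot P →ₗ.[ℂ] Htot P) (f : Htot P) : Htot P :=
  if h : f ∈ T.domain then T ⟨f, h⟩ else 0

/-- `u_M(X) = ((dΓ(M_ω))⁻¹ ⊗ I) H_int(M) (Ψ₀ ⊗ X)`. -/
def corrector (φ : 𝓢(ℝ, ℂ)) (x : Fin P → R3) (M : EuclideanSpace ℝ (Fin P)) (X : Hsp P) :
    Htot P :=
  value (opTensor photonEnergyInv 1) (value (interaction φ x M) (vacuumEmbedding P X))

/-- `A_M X = - E* H_int(M) ((dΓ(M_ω))⁻¹ ⊗ I) H_int(M) E X`. -/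
def AOp (φ : 𝓢(ℝ, ℂ)) (x : Fin P → R3) (M : EuclideanSpace ℝ (Fin P)) (X : Hsp P) : Hsp P :=
  -ContinuousLinearMap.adjoint (vacuumEmbedding P) (value (interaction φ x M) (corrector φ x M X))

/-- All operators in the formula for `A_M X` are applied to elements of their domains. -/
def AOpDefined (φ : 𝓢(ℝ, ℂ)) (x : Fin P → R3) (M : EuclideanSpace ℝ (Fin P)) (X : Hsp P) : Prop :=
  vacuumEmbedding P X ∈ (interaction φ x M).domain ∧
  value (interaction φ x M) (vacuumEmbedding P X) ∈
    (opTensor photonEnergyInv 1 : Htot P →ₗ.[ℂ] Htot P).domain ∧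
  corrector φ x M X ∈ (interaction φ x M).domain

/-- `K` satisfies `‖u_M(X)‖_{D(H)} ≤ K |M| |X|` for all `M` and `X`. -/
def IsCorrectorBound (φ : 𝓢(ℝ, ℂ)) (x : Fin P → R3) (K : ℝ) : Prop :=
  ∀ (M : EuclideanSpace ℝ (Fin P)) (X : Hsp P),
    ∃ h : corrector φ x M X ∈ (freeHamiltonian P).domain, domainNorm ⟨_, h⟩ ≤ K * ‖M‖ * ‖X‖

end SpinPhoton

end

open SpinPhoton

/-!
The energy near the vacuum is computed by completing the square. Write `w = H_int(M) (Ψ₀ ⊗ X)` and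
`u = u_M(X)`, so that `H_ph u = w`. For `f = Ψ₀ ⊗ X + h` with `h ∈ D(H)`, the symmetry of `H_ph`
and `H_int(M)`, `H_ph Ψ₀ = 0` and `w ⊥ Ψ₀ ⊗ X` give (`inner_energy`)

  `⟨H(M) f, f⟩ = ⟨H_ph (h + u), h + u⟩ - ⟨w, u⟩ + ⟨H_int(M) h, h⟩`.

The first term is nonnegative and vanishes at `h = -u`, which is in the ball as soon as `K ≤ ρ`;
the second one is `⟨A_M X, X⟩` (`inner_AOp`). The third one is at most `C |M| ‖h‖²_{D(H)}`, hence
at most `C ρ² |M|³ |X|²`, because `H_int(M)` is bounded relative to `H_ph` with a constant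
proportional to `|M|` (`exists_interaction`).

The relative bound holds because `B_{m,x} / |k|` is still square integrable (`memLp_BDivFun`). For
one-photon functions `V = |k| W`, it comes from pointwise inequalities: a weighted Cauchy–Schwarz
inequality for `a*(V)` (`norm_creation_sq_le`) and Young's inequality for `a(V)`
(`norm_adjoint_creation_sq_le`). Neither uses the permutation symmetry of the wave functions or
the commutation relations. The same function
`B_{m,x} / |k|` makes the corrector `u` explicit: it is `w` with each `B_{m,x}` replaced by
`B_{m,x} / |k|` (`corrector_eq`).

Unbounded operators are handled through their graphs: `(f, y) ∈ T.graph` says that `f` is in the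
domain of `T` and that `T f = y`.
-/

noncomputable section

namespace SpinPhoton

/-! ### Square-integrable functions and division by the frequency -/

lemma Lp_two_norm_sq {α E : Type*} [MeasurableSpace α] {μ : Measure α} [NormedAddCommGroup E]
    [InnerProductSpace ℂ E] (f : Lp E 2 μ) : ‖f‖ ^ 2 = ∫ a, ‖f a‖ ^ 2 ∂μ := by
  have h := L2.inner_def (𝕜 := ℂ) f f
  have h2 : ∀ a, inner ℂ (f a) (f a) = ((‖f a‖ ^ 2 : ℝ) : ℂ) := fun a => by
    rw [inner_self_eq_norm_sq_to_K]; simp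
  simp only [h2] at h
  rw [integral_complex_ofReal, inner_self_eq_norm_sq_to_K] at h
  exact Complex.ofReal_injective (by rw [← h]; simp)

lemma Lp_two_integrable_norm_sq {α E : Type*} [MeasurableSpace α] {μ : Measure α}
    [NormedAddCommGroup E] (f : Lp E 2 μ) : Integrable (fun a => ‖f a‖ ^ 2) μ :=
  (memLp_two_iff_integrable_sq_norm (Lp.memLp f).1).1 (Lp.memLp f)

/-- `V = |k| W` for one-photon functions `V` and `W`. -/
def IsFrequencyMul (V W : onePhoton) : Prop :=
  ∀ᵐ k : R3, (V : Lp (EuclideanSpace ℂ (Fin 3)) 2 (volume : Measure R3)) k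
    = ((‖k‖ : ℝ) : ℂ) • (W : Lp (EuclideanSpace ℂ (Fin 3)) 2 (volume : Measure R3)) k

/-- `g = (|k₁| + ⋯ + |kₙ|) f` for `n`-photon functions: the action of `dΓ(M_ω)` on the
`n`-photon space. -/
def IsEnergyMul {n : ℕ} (f g : NL2 n) : Prop :=
  ∀ᵐ k : Fin n → R3, g k = ((∑ l, ‖k l‖ : ℝ) : ℂ) • f k

/-! ### Bounds on the creation and annihilation operators -/

lemma norm_insertL {n : ℕ} (V : Lp (EuclideanSpace ℂ (Fin 3)) 2 (volume : Measure R3))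
    (l : Fin (n + 1)) (f : NL2 n) : ‖insertL n V l f‖ = ‖V‖ * ‖f‖ := by
  change ‖(memLp_insertFun l (Lp.memLp V) (Lp.memLp f)).toLp _‖ = _
  rw [Lp.norm_toLp, eLpNorm_insertFun l (Lp.memLp V).1 (Lp.memLp f).1, ENNReal.toReal_mul,
    Lp.norm_def, Lp.norm_def]

lemma coe_creation (V : onePhoton) (n : ℕ) (h : nPhoton n) :
    (creation V n h : NL2 (n + 1))
      = (((Real.sqrt (n + 1))⁻¹ : ℝ) : ℂ) • ∑ l, insertL n V l (h : NL2 n) := by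
  simp [creation]

lemma coeFn_sum_insertL (V : Lp (EuclideanSpace ℂ (Fin 3)) 2 (volume : Measure R3)) (n : ℕ)
    (h : NL2 n) :
    ∀ᵐ k : Fin (n + 1) → R3, (∑ l, insertL n V l h : NL2 (n + 1)) k
      = ∑ l, insertFun l V h k := by
  have h1 : ∀ᵐ k, ∀ l, insertL n V l h k = insertFun l V h k :=
    ae_all_iff.2 fun l => coeFn_insertL n V l h
  have h2 := Lp.coeFn_finsetSum (p := 2) (μ := (volume : Measure (Fin (n + 1) → R3)))
    Finset.univ (fun l => insertL n V l h)
  filter_upwards [h1, h2] with k h1 h2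
  rw [h2, Finset.sum_apply]
  exact Finset.sum_congr rfl fun l _ => h1 l

/-- Cauchy–Schwarz with the weights `rₗ`, followed by `2 rₗ (S - rₗ) ≤ rₗ² + (S - rₗ)²`, where
`S = ∑ₗ rₗ`. -/
lemma sq_sum_mul_le {ι : Type*} [Fintype ι] (r b : ι → ℝ) (hr : ∀ l, 0 ≤ r l) :
    (∑ l, r l * b l) ^ 2
      ≤ ∑ l, (3 / 2 * (r l * b l) ^ 2 + 1 / 2 * ((∑ i, r i - r l) * b l) ^ 2) := by
  have h1 : (∑ l, r l * b l) ^ 2 ≤ (∑ l, r l) * ∑ l, r l * b l ^ 2 :=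
    Finset.sum_sq_le_sum_mul_sum_of_sq_le_mul _ (fun l _ => hr l)
      (fun l _ => mul_nonneg (hr l) (sq_nonneg _)) (fun l _ => le_of_eq (by ring))
  refine h1.trans ?_
  rw [Finset.mul_sum]
  refine Finset.sum_le_sum fun l _ => ?_
  nlinarith [mul_nonneg (sq_nonneg (r l - (∑ i, r i - r l))) (sq_nonneg (b l))]

/-- The pointwise form of the bound on the creation operator. -/
lemma norm_sum_insertFun_sq_le {n : ℕ} {V W : R3 → EuclideanSpace ℂ (Fin 3)}
    {h g : (Fin n → R3) → Pol n} {k : Fin (n + 1) → R3}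
    (hV : ∀ l, V (k l) = ((‖k l‖ : ℝ) : ℂ) • W (k l))
    (hg : ∀ l : Fin (n + 1), g (fun i => k (l.succAbove i))
      = ((∑ i, ‖k (l.succAbove i)‖ : ℝ) : ℂ) • h (fun i => k (l.succAbove i))) :
    ‖∑ l, insertFun l V h k‖ ^ 2
      ≤ ∑ l, (3 / 2 * ‖insertFun l V h k‖ ^ 2 + 1 / 2 * ‖insertFun l W g k‖ ^ 2) := by
  have h1 : ∀ l, ‖insertFun l V h k‖
      = ‖k l‖ * (‖W (k l)‖ * ‖h (fun i => k (l.succAbove i))‖) := fun l => by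
    rw [norm_insertFun, hV, norm_smul, Complex.norm_real, norm_norm, mul_assoc]
  have h2 : ∀ l, ‖insertFun l W g k‖
      = (∑ i, ‖k i‖ - ‖k l‖) * (‖W (k l)‖ * ‖h (fun i => k (l.succAbove i))‖) := fun l => by
    rw [norm_insertFun, hg, norm_smul, Complex.norm_real,
      Real.norm_of_nonneg (Finset.sum_nonneg fun i _ => norm_nonneg _),
      Fin.sum_univ_succAbove (fun i => ‖k i‖) l]
    ring
  calc ‖∑ l, insertFun l V h k‖ ^ 2 ≤ (∑ l, ‖insertFun l V h k‖) ^ 2 := by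
        gcongr; exact norm_sum_le _ _
    _ ≤ _ := by
        simp only [h1, h2]
        exact sq_sum_mul_le (fun l => ‖k l‖) _ fun l => norm_nonneg _

lemma norm_creation_sq_le {V W : onePhoton} (hVW : IsFrequencyMul V W) {n : ℕ} (h g : nPhoton n)
    (hg : IsEnergyMul (h : NL2 n) g) :
    ‖creation V n h‖ ^ 2 ≤ 3 / 2 * ‖V‖ ^ 2 * ‖h‖ ^ 2 + 1 / 2 * ‖W‖ ^ 2 * ‖g‖ ^ 2 := by
  have hn : (0 : ℝ) < n + 1 := by positivity
  set S : NL2 (n + 1) := ∑ l, insertL n V l (h : NL2 n) with hS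
  have h1 : ‖creation V n h‖ ^ 2 = ((n : ℝ) + 1)⁻¹ * ‖S‖ ^ 2 := by
    rw [Submodule.coe_norm, coe_creation, norm_smul, mul_pow, Complex.norm_real, norm_inv,
      inv_pow, Real.norm_of_nonneg (Real.sqrt_nonneg _), Real.sq_sqrt hn.le]
  have hint : ∀ l : Fin (n + 1), Integrable (fun k => 3 / 2 * ‖insertL n V l (h : NL2 n) k‖ ^ 2
      + 1 / 2 * ‖insertL n W l (g : NL2 n) k‖ ^ 2) volume := fun l =>
    ((Lp_two_integrable_norm_sq _).const_mul _).add ((Lp_two_integrable_norm_sq _).const_mul _)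
  have h2 : ‖S‖ ^ 2 ≤ ∑ l : Fin (n + 1), (3 / 2 * ‖insertL n V l (h : NL2 n)‖ ^ 2
      + 1 / 2 * ‖insertL n W l (g : NL2 n)‖ ^ 2) := by
    calc ‖S‖ ^ 2 = ∫ k, ‖S k‖ ^ 2 := Lp_two_norm_sq S
      _ ≤ ∫ k, ∑ l : Fin (n + 1), (3 / 2 * ‖insertL n V l (h : NL2 n) k‖ ^ 2
          + 1 / 2 * ‖insertL n W l (g : NL2 n) k‖ ^ 2) := by
        refine integral_mono_ae (Lp_two_integrable_norm_sq S)
          (integrable_finsetSum _ fun l _ => hint l) ?_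
        have a1 : ∀ᵐ k : Fin (n + 1) → R3, ∀ l, insertL n V l (h : NL2 n) k
            = insertFun l V (h : NL2 n) k := ae_all_iff.2 fun l => coeFn_insertL n V l _
        have a2 : ∀ᵐ k : Fin (n + 1) → R3, ∀ l, insertL n W l (g : NL2 n) k
            = insertFun l W (g : NL2 n) k := ae_all_iff.2 fun l => coeFn_insertL n W l _
        filter_upwards [a1, a2, coeFn_sum_insertL V n (h : NL2 n),
          ae_all_iff.2 fun l : Fin (n + 1) => (quasi_fst l).ae hVW,
          ae_all_iff.2 fun l : Fin (n + 1) => (quasi_snd l).ae hg] with k a1 a2 a3 a4 a5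
        simp only [a1, a2, hS, a3]
        exact norm_sum_insertFun_sq_le a4 a5
      _ = _ := by
        rw [integral_finsetSum _ fun l _ => hint l]
        refine Finset.sum_congr rfl fun l _ => ?_
        rw [integral_add ((Lp_two_integrable_norm_sq _).const_mul _)
          ((Lp_two_integrable_norm_sq _).const_mul _), integral_const_mul, integral_const_mul,
          Lp_two_norm_sq, Lp_two_norm_sq]
  simp only [norm_insertL, Submodule.norm_coe, Finset.sum_const, Finset.card_univ,
    Fintype.card_fin, nsmul_eq_mul, Nat.cast_add, Nat.cast_one] at h2
  rw [h1, inv_mul_le_iff₀ hn]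
  refine h2.trans (le_of_eq ?_)
  ring

/-- Young's inequality for `∑ₗ rₗ bₗ c` against `(∑ₗ rₗ) c`; the factor `√m` is the
normalization of the creation operator. -/
lemma two_mul_sum_mul_le {m : ℕ} (r b : Fin m → ℝ) (c s : ℝ) (hs : 0 < s) (hr : ∀ l, 0 ≤ r l) :
    2 * ∑ l, r l * b l * c
      ≤ Real.sqrt m * ((s / m) * ∑ l, b l ^ 2 + s⁻¹ * ((∑ l, r l) * c) ^ 2) := by
  rcases Nat.eq_zero_or_pos m with rfl | hm
  · simp
  have hm' : (0 : ℝ) < m := by exact_mod_cast hm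
  have hq : 0 < Real.sqrt m := Real.sqrt_pos.2 hm'
  have hq2 : Real.sqrt m ^ 2 = m := Real.sq_sqrt hm'.le
  have h1 : ∑ l, r l ^ 2 ≤ (∑ l, r l) ^ 2 :=
    Finset.sum_sq_le_sq_sum_of_nonneg fun l _ => hr l
  have h2 : ∀ l, 2 * (r l * b l * c)
      ≤ Real.sqrt m * (s / m * b l ^ 2 + s⁻¹ * (r l ^ 2 * c ^ 2)) := by
    intro l
    have e : Real.sqrt m * (s / m * b l ^ 2 + s⁻¹ * (r l ^ 2 * c ^ 2)) - 2 * (r l * b l * c)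
        = (s / Real.sqrt m) * (b l - Real.sqrt m * s⁻¹ * (r l * c)) ^ 2 := by
      nth_rewrite 2 [← hq2]
      field_simp
      ring
    have : 0 ≤ (s / Real.sqrt m) * (b l - Real.sqrt m * s⁻¹ * (r l * c)) ^ 2 := by positivity
    linarith
  calc 2 * ∑ l, r l * b l * c
      ≤ ∑ l, Real.sqrt m * (s / m * b l ^ 2 + s⁻¹ * (r l ^ 2 * c ^ 2)) := by
        rw [Finset.mul_sum]; exact Finset.sum_le_sum fun l _ => h2 l
    _ = Real.sqrt m * ((s / m) * ∑ l, b l ^ 2 + s⁻¹ * ((∑ l, r l ^ 2) * c ^ 2)) := by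
        rw [← Finset.mul_sum, Finset.sum_add_distrib, ← Finset.mul_sum, ← Finset.mul_sum,
          ← Finset.sum_mul]
    _ ≤ _ := by
        rw [mul_pow]
        gcongr

lemma two_mul_re_inner_creation_le {V W : onePhoton} (hVW : IsFrequencyMul V W) {n : ℕ}
    (y : nPhoton n) (h g : nPhoton (n + 1)) (hg : IsEnergyMul (h : NL2 (n + 1)) g) {s : ℝ}
    (hs : 0 < s) :
    2 * (inner ℂ (creation V n y) h).re ≤ s * ‖W‖ ^ 2 * ‖y‖ ^ 2 + s⁻¹ * ‖g‖ ^ 2 := by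
  have hn : (0 : ℝ) < n + 1 := by positivity
  have hq : 0 < Real.sqrt (n + 1) := Real.sqrt_pos.2 hn
  set S : NL2 (n + 1) := ∑ l, insertL n V l (y : NL2 n) with hS
  have h1 : (inner ℂ (creation V n y) h).re
      = (Real.sqrt (n + 1))⁻¹ * (inner ℂ S (h : NL2 (n + 1))).re := by
    rw [Submodule.coe_inner, coe_creation, inner_smul_left, Complex.conj_ofReal,
      Complex.re_ofReal_mul]
  have hint : ∀ l : Fin (n + 1),
      Integrable (fun k => ‖insertL n W l (y : NL2 n) k‖ ^ 2) volume := fun l =>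
    Lp_two_integrable_norm_sq _
  have hint2 : Integrable (fun k => Real.sqrt (n + 1) * ((s / (n + 1))
      * ∑ l : Fin (n + 1), ‖insertL n W l (y : NL2 n) k‖ ^ 2
        + s⁻¹ * ‖(g : NL2 (n + 1)) k‖ ^ 2)) volume :=
    (((integrable_finsetSum _ fun l _ => hint l).const_mul _).add
      ((Lp_two_integrable_norm_sq _).const_mul _)).const_mul _
  have h2 : 2 * (inner ℂ S (h : NL2 (n + 1))).re ≤ Real.sqrt (n + 1) * ((s / (n + 1))
      * ∑ l : Fin (n + 1), ‖insertL n W l (y : NL2 n)‖ ^ 2 + s⁻¹ * ‖g‖ ^ 2) := by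
    have e1 : (inner ℂ S (h : NL2 (n + 1))).re = ∫ k, (inner ℂ (S k) ((h : NL2 (n + 1)) k)).re := by
      rw [L2.inner_def]
      exact (integral_re (L2.integrable_inner (𝕜 := ℂ) S (h : NL2 (n + 1)))).symm
    have e2 : Real.sqrt (n + 1) * ((s / (n + 1))
        * ∑ l : Fin (n + 1), ‖insertL n W l (y : NL2 n)‖ ^ 2 + s⁻¹ * ‖g‖ ^ 2)
        = ∫ k, Real.sqrt (n + 1) * ((s / (n + 1))
          * ∑ l : Fin (n + 1), ‖insertL n W l (y : NL2 n) k‖ ^ 2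
            + s⁻¹ * ‖(g : NL2 (n + 1)) k‖ ^ 2) := by
      rw [integral_const_mul, integral_add
        ((integrable_finsetSum _ fun l _ => hint l).const_mul _)
        ((Lp_two_integrable_norm_sq _).const_mul _), integral_const_mul, integral_const_mul,
        integral_finsetSum _ fun l _ => hint l, ← Lp_two_norm_sq, Submodule.coe_norm]
      simp only [Lp_two_norm_sq (insertL n _ _ _)]
    rw [e1, e2, ← integral_const_mul]
    refine integral_mono_ae
      ((L2.integrable_inner (𝕜 := ℂ) S (h : NL2 (n + 1))).re.const_mul _) hint2 ?_
    have a2 : ∀ᵐ k : Fin (n + 1) → R3, ∀ l, insertL n W l (y : NL2 n) k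
        = insertFun l W (y : NL2 n) k := ae_all_iff.2 fun l => coeFn_insertL n W l _
    filter_upwards [a2, coeFn_sum_insertL V n (y : NL2 n), hg,
      ae_all_iff.2 fun l : Fin (n + 1) => (quasi_fst l).ae hVW] with k a2 a3 a4 a5
    simp only [hS, a2, a3, a4]
    have b1 : ∀ l, ‖insertFun l V (y : NL2 n) k‖ = ‖k l‖ * ‖insertFun l W (y : NL2 n) k‖ := by
      intro l
      rw [norm_insertFun, norm_insertFun, a5, norm_smul, Complex.norm_real, norm_norm, mul_assoc]
    have b2 : (inner ℂ (∑ l, insertFun l V (y : NL2 n) k) ((h : NL2 (n + 1)) k)).re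
        ≤ ∑ l, ‖k l‖ * ‖insertFun l W (y : NL2 n) k‖ * ‖(h : NL2 (n + 1)) k‖ := by
      refine (Complex.re_le_norm _).trans ((norm_inner_le_norm _ _).trans ?_)
      rw [← Finset.sum_mul]
      gcongr
      refine (norm_sum_le _ _).trans (le_of_eq ?_)
      exact Finset.sum_congr rfl fun l _ => b1 l
    have b3 := two_mul_sum_mul_le (fun l => ‖k l‖) (fun l => ‖insertFun l W (y : NL2 n) k‖)
      ‖(h : NL2 (n + 1)) k‖ s hs fun l => norm_nonneg _
    rw [norm_smul, Complex.norm_real,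
      Real.norm_of_nonneg (Finset.sum_nonneg fun i _ => norm_nonneg _)]
    push_cast at b3
    linarith
  simp only [norm_insertL, Finset.sum_const, Finset.card_univ, Submodule.norm_coe,
    Fintype.card_fin, nsmul_eq_mul, Nat.cast_add, Nat.cast_one] at h2
  have e : s / ((n : ℝ) + 1) * (((n : ℝ) + 1) * (‖W‖ * ‖y‖) ^ 2) = s * ‖W‖ ^ 2 * ‖y‖ ^ 2 := by
    field_simp
  rw [e] at h2
  rw [h1, mul_left_comm, inv_mul_le_iff₀ hq]
  exact h2

lemma norm_adjoint_creation_sq_le {V W : onePhoton} (hVW : IsFrequencyMul V W) {n : ℕ}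
    (h g : nPhoton (n + 1)) (hg : IsEnergyMul (h : NL2 (n + 1)) g) :
    ‖ContinuousLinearMap.adjoint (creation V n) h‖ ^ 2 ≤ (‖W‖ ^ 2 + 1) * ‖g‖ ^ 2 := by
  set y := ContinuousLinearMap.adjoint (creation V n) h with hy
  -- With `s = (‖W‖² + 1)⁻¹` the term `s ‖W‖² ‖y‖²` is absorbed by `2 ⟨a*(V) y, h⟩ = 2 ‖y‖²`.
  have hs : 0 < (‖W‖ ^ 2 + 1)⁻¹ := by positivity
  have h1 := two_mul_re_inner_creation_le hVW y h g hg hs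
  have h2 : (inner ℂ (creation V n y) h).re = ‖y‖ ^ 2 := by
    rw [← ContinuousLinearMap.adjoint_inner_right, ← hy, inner_self_eq_norm_sq_to_K]
    norm_cast
  have h3 : (‖W‖ ^ 2 + 1)⁻¹ * ‖W‖ ^ 2 ≤ 1 := by
    rw [inv_mul_le_iff₀ (by positivity)]; linarith
  rw [h2, inv_inv] at h1
  nlinarith [mul_le_mul_of_nonneg_right h3 (sq_nonneg ‖y‖)]

/-! ### Unbounded operators in the Fock space -/

lemma hasSum_norm_sq (F : Fock) : HasSum (fun n => ‖F n‖ ^ 2) (‖F‖ ^ 2) := by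
  have h := lp.hasSum_norm (p := 2) (by norm_num) F
  simpa using h

lemma exists_fock_of_norm_sq_le (f : ∀ n, nPhoton n) {b : ℕ → ℝ} {B : ℝ} (hb : HasSum b B)
    (h : ∀ n, ‖f n‖ ^ 2 ≤ b n) : ∃ F : Fock, (∀ n, F n = f n) ∧ ‖F‖ ^ 2 ≤ B := by
  have hs : Summable fun n => ‖f n‖ ^ 2 :=
    Summable.of_nonneg_of_le (fun n => sq_nonneg _) h hb.summable
  have hm : Memℓp f 2 := memℓp_gen (by simpa using hs)
  refine ⟨⟨f, hm⟩, fun n => rfl, ?_⟩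
  exact hasSum_le h (hasSum_norm_sq ⟨f, hm⟩) hb

lemma hasSum_nat_succ_le {b : ℕ → ℝ} {S : ℝ} (h : HasSum b S) (hb : 0 ≤ b 0) :
    ∃ B, HasSum (fun n => b (n + 1)) B ∧ B ≤ S := by
  refine ⟨_, (hasSum_nat_add_iff' 1).2 h, ?_⟩
  simpa using hb

lemma hasSum_nat_casesOn_zero {b : ℕ → ℝ} {S : ℝ} (h : HasSum b S) :
    HasSum (fun n => (Nat.casesOn n 0 b : ℝ)) S :=
  (hasSum_nat_add_iff' 1).1 (by simpa using h)

lemma mem_photonEnergyGraph {f g : Fock} :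
    (f, g) ∈ photonEnergyGraph ↔ ∀ n, IsEnergyMul (f n : NL2 n) (g n) := Iff.rfl

lemma photonEnergy_graph : photonEnergy.graph = photonEnergyGraph := by
  refine Submodule.toLinearPMap_graph_eq _ fun p hp h0 => ?_
  ext1
  funext n
  refine Subtype.ext (Lp.ext ?_)
  filter_upwards [hp n, Lp.coeFn_zero (Pol n) 2 (volume : Measure (Fin n → R3))] with k h1 h2
  rw [h1, h0]
  simp only [lp.coeFn_zero, Pi.zero_apply, Submodule.coe_zero]
  rw [h2]
  simp

lemma mem_segalGraph {V : onePhoton} {f g : Fock} : (f, g) ∈ segalGraph V ↔ ∀ n, g n =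
    (((Real.sqrt 2)⁻¹ : ℝ) : ℂ) • (annihilationPart V n f + creationPart V n f) := Iff.rfl

lemma segalField_graph (V : onePhoton) : (segalField V).graph = segalGraph V := by
  refine Submodule.toLinearPMap_graph_eq _ fun p hp h0 => ?_
  ext1
  funext n
  rw [hp n, h0]
  simp

lemma IsEnergyMul.inner_left {n : ℕ} {f f' g g' : NL2 n} (hf : IsEnergyMul f f')
    (hg : IsEnergyMul g g') : inner ℂ f' g = inner ℂ f g' := by
  rw [L2.inner_def, L2.inner_def]
  refine integral_congr_ae ?_
  filter_upwards [hf, hg] with k h1 h2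
  rw [h1, h2, inner_smul_left, inner_smul_right, Complex.conj_ofReal]

lemma IsEnergyMul.re_inner_nonneg {n : ℕ} {f f' : NL2 n} (hf : IsEnergyMul f f') :
    0 ≤ (inner ℂ f' f).re := by
  rw [L2.inner_def]
  change 0 ≤ RCLike.re (_ : ℂ)
  rw [← integral_re (L2.integrable_inner (𝕜 := ℂ) f' f)]
  refine integral_nonneg_of_ae ?_
  filter_upwards [hf] with k h1
  rw [h1, inner_smul_left, Complex.conj_ofReal, inner_self_eq_norm_sq_to_K]
  have : ((∑ l, ‖k l‖ : ℝ) : ℂ) * ((‖f k‖ : ℝ) : ℂ) ^ 2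
      = (((∑ l, ‖k l‖) * ‖f k‖ ^ 2 : ℝ) : ℂ) := by push_cast; ring
  change 0 ≤ (((∑ l, ‖k l‖ : ℝ) : ℂ) * ((‖f k‖ : ℝ) : ℂ) ^ 2).re
  rw [this, Complex.ofReal_re]
  positivity

lemma photonEnergy_symm {f f' g g' : Fock} (hf : (f, f') ∈ photonEnergyGraph)
    (hg : (g, g') ∈ photonEnergyGraph) : inner ℂ f' g = inner ℂ f g' := by
  rw [lp.inner_eq_tsum, lp.inner_eq_tsum]
  exact tsum_congr fun n => (mem_photonEnergyGraph.1 hf n).inner_left (mem_photonEnergyGraph.1 hg n)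

lemma photonEnergy_nonneg {f f' : Fock} (hf : (f, f') ∈ photonEnergyGraph) :
    0 ≤ (inner ℂ f' f).re := by
  rw [lp.inner_eq_tsum, Complex.re_tsum (lp.summable_inner f' f)]
  exact tsum_nonneg fun n => (mem_photonEnergyGraph.1 hf n).re_inner_nonneg

/-! ### Relative boundedness and symmetry of the Segal field -/

/-- The constant in the bound of `Φ_S(V)` relative to `dΓ(M_ω)`, where `V = |k| W`. -/
def segalBound (V W : onePhoton) : ℝ := 3 / 2 * ‖V‖ ^ 2 + 3 / 2 * ‖W‖ ^ 2 + 1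

/-- On the domain of `dΓ(M_ω)`, both `a(V)` and `a*(V)` are defined, and are relatively bounded. -/
lemma exists_annihilation_creation {V W : onePhoton} (hVW : IsFrequencyMul V W) {f f' : Fock}
    (hf : (f, f') ∈ photonEnergyGraph) : ∃ a b : Fock, (∀ n, a n = annihilationPart V n f) ∧
      (∀ n, b n = creationPart V n f) ∧ ‖a‖ ^ 2 + ‖b‖ ^ 2
        ≤ segalBound V W * (‖f'‖ ^ 2 + ‖f‖ ^ 2) := by
  obtain ⟨B, hB, hB'⟩ := hasSum_nat_succ_le (b := fun n => ‖f' n‖ ^ 2) (hasSum_norm_sq f')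
    (sq_nonneg _)
  obtain ⟨a, ha, ha'⟩ := exists_fock_of_norm_sq_le (fun n => annihilationPart V n f)
    (hB.mul_left (‖W‖ ^ 2 + 1)) fun n => norm_adjoint_creation_sq_le hVW (f (n + 1)) (f' (n + 1))
      (mem_photonEnergyGraph.1 hf (n + 1))
  have hsum := ((hasSum_norm_sq f).mul_left (3 / 2 * ‖V‖ ^ 2)).add
    ((hasSum_norm_sq f').mul_left (1 / 2 * ‖W‖ ^ 2))
  obtain ⟨b, hb, hb'⟩ := exists_fock_of_norm_sq_le (fun n => creationPart V n f)
    (hasSum_nat_casesOn_zero hsum) (by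
      rintro (_ | n)
      · simp [creationPart]
      · exact norm_creation_sq_le hVW (f n) (f' n) (mem_photonEnergyGraph.1 hf n))
  refine ⟨a, b, ha, hb, ?_⟩
  simp only [segalBound]
  have h1 : (‖W‖ ^ 2 + 1) * B ≤ (‖W‖ ^ 2 + 1) * ‖f'‖ ^ 2 := by gcongr
  nlinarith [sq_nonneg ‖W‖, sq_nonneg ‖V‖, sq_nonneg ‖f‖, sq_nonneg ‖f'‖,
    mul_nonneg (sq_nonneg ‖V‖) (sq_nonneg ‖f'‖), mul_nonneg (sq_nonneg ‖W‖) (sq_nonneg ‖f‖)]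

lemma exists_segal {V W : onePhoton} (hVW : IsFrequencyMul V W) {f f' : Fock}
    (hf : (f, f') ∈ photonEnergyGraph) : ∃ y : Fock, (f, y) ∈ segalGraph V ∧
      ‖y‖ ^ 2 ≤ segalBound V W * (‖f'‖ ^ 2 + ‖f‖ ^ 2) := by
  obtain ⟨a, b, ha, hb, h⟩ := exists_annihilation_creation hVW hf
  refine ⟨(((Real.sqrt 2)⁻¹ : ℝ) : ℂ) • (a + b), mem_segalGraph.2 fun n => ?_, ?_⟩
  · rw [lp.coeFn_smul, Pi.smul_apply, lp.coeFn_add, Pi.add_apply, ha, hb]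
  · refine le_trans ?_ h
    rw [norm_smul, mul_pow, Complex.norm_real, norm_inv, inv_pow,
      Real.norm_of_nonneg (Real.sqrt_nonneg _), Real.sq_sqrt (by norm_num)]
    nlinarith [norm_add_le a b, norm_nonneg (a + b), sq_nonneg (‖a‖ - ‖b‖),
      mul_self_le_mul_self (norm_nonneg (a + b)) (norm_add_le a b)]

lemma inner_annihilation {V : onePhoton} {f g a b : Fock} (ha : ∀ n, a n = annihilationPart V n f)
    (hb : ∀ n, b n = creationPart V n g) : inner ℂ a g = inner ℂ f b := by
  have h0 : inner ℂ (f 0) (b 0) = 0 := by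
    rw [hb 0]; exact inner_zero_right _
  have h : HasSum (fun n => inner ℂ (f (n + 1)) (b (n + 1))) (inner ℂ f b) := by
    have h1 := lp.hasSum_inner (𝕜 := ℂ) f b
    generalize inner ℂ f b = S at h1 ⊢
    have h2 := (hasSum_nat_add_iff' (f := fun n => inner ℂ (f n) (b n)) 1).2 h1
    simp only [Finset.range_one, Finset.sum_singleton] at h2
    rwa [h0, sub_zero] at h2
  refine (lp.hasSum_inner a g).unique (h.congr_fun fun n => ?_)
  rw [ha, hb]
  exact ContinuousLinearMap.adjoint_inner_left (creation V n) (g n) (f (n + 1))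

/-- `Φ_S(V)` is symmetric on the domain of `dΓ(M_ω)`, because `a(V)` and `a*(V)` are formal
adjoints of each other there. -/
lemma segal_symm {V W : onePhoton} (hVW : IsFrequencyMul V W) {f f' g g' y z : Fock}
    (hf : (f, f') ∈ photonEnergyGraph) (hg : (g, g') ∈ photonEnergyGraph)
    (hy : (f, y) ∈ segalGraph V) (hz : (g, z) ∈ segalGraph V) : inner ℂ y g = inner ℂ f z := by
  obtain ⟨a, b, ha, hb, -⟩ := exists_annihilation_creation hVW hf
  obtain ⟨c, d, hc, hd, -⟩ := exists_annihilation_creation hVW hg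
  have e1 : y = (((Real.sqrt 2)⁻¹ : ℝ) : ℂ) • (a + b) := by
    ext1; funext n
    rw [mem_segalGraph.1 hy n, lp.coeFn_smul, Pi.smul_apply, lp.coeFn_add, Pi.add_apply, ha, hb]
  have e2 : z = (((Real.sqrt 2)⁻¹ : ℝ) : ℂ) • (c + d) := by
    ext1; funext n
    rw [mem_segalGraph.1 hz n, lp.coeFn_smul, Pi.smul_apply, lp.coeFn_add, Pi.add_apply, hc, hd]
  have h1 := inner_annihilation ha hd
  have h2 : inner ℂ b g = inner ℂ f c := by
    rw [← inner_conj_symm, ← inner_annihilation hc hb, inner_conj_symm]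
  rw [e1, e2, inner_smul_left, inner_smul_right, Complex.conj_ofReal, inner_add_left,
    inner_add_right, h1, h2, add_comm]

/-! ### The vacuum and the one-photon states -/

lemma ae_zero_ne {n : ℕ} : ∀ᵐ k : Fin (n + 1) → R3, k 0 ≠ 0 :=
  (quasi_fst 0).ae (Measure.ae_ne volume 0)

lemma vacuum_mem : (vacuum, 0) ∈ photonEnergyGraph := by
  refine mem_photonEnergyGraph.2 fun n => ?_
  have hz := Lp.coeFn_zero (Pol n) 2 (volume : Measure (Fin n → R3))
  rcases n with _ | n
  · filter_upwards [hz] with k h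
    simp only [lp.coeFn_zero, Pi.zero_apply, Submodule.coe_zero, h]
    simp
  · filter_upwards [hz] with k h
    have : vacuum (n + 1) = 0 := lp.single_apply_ne _ _ _ (by simp)
    simp only [lp.coeFn_zero, Pi.zero_apply, Submodule.coe_zero, this, h, smul_zero]

lemma Pol_zero_ext {v w : Pol 0} (h : v (fun i => i.elim0) = w (fun i => i.elim0)) : v = w := by
  ext a
  rw [Subsingleton.elim a fun i => i.elim0, h]

lemma coeFn_vacuumZero :
    (vacuumZero : NL2 0) =ᵐ[volume] fun _ => (WithLp.toLp 2 (fun _ => 1) : Pol 0) :=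
  MemLp.coeFn_toLp (μ := (volume : Measure (Fin 0 → R3))) (p := 2)
    (f := fun _ => (WithLp.toLp 2 (fun _ => 1) : Pol 0)) (by
      have : IsFiniteMeasure (volume : Measure (Fin 0 → R3)) := by
        rw [volume_pi, Measure.pi_of_empty]; infer_instance
      exact memLp_const _)

/-- The zero-photon space is spanned by the vacuum. -/
lemma exists_smul_vacuumZero (f : nPhoton 0) : ∃ c : ℂ, f = c • vacuumZero := by
  refine ⟨(f : NL2 0) 0 (fun i => i.elim0), Subtype.ext (Lp.ext ?_)⟩
  rw [Submodule.coe_smul]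
  filter_upwards [coeFn_vacuumZero, Lp.coeFn_smul ((f : NL2 0) 0 (fun i => i.elim0)) (vacuumZero : NL2 0)]
    with k h1 h2
  rw [h2, Pi.smul_apply, h1]
  apply Pol_zero_ext
  rw [Subsingleton.elim k 0]
  simp

lemma vacuumZero_norm : ‖vacuumZero‖ = 1 := by
  have h : ‖vacuumZero‖ ^ 2 = 1 := by
    rw [Submodule.coe_norm, Lp_two_norm_sq]
    rw [integral_congr_ae (coeFn_vacuumZero.mono fun k hk => by
      change ‖(vacuumZero : NL2 0) k‖ ^ 2 = (1 : ℝ)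
      rw [hk, EuclideanSpace.norm_eq]; simp)]
    rw [volume_pi, Measure.pi_of_empty]
    simp
  nlinarith [norm_nonneg vacuumZero]

/-- The kernel of `dΓ(M_ω)` is spanned by the vacuum. -/
lemma eq_zero_of_photonEnergy_eq_zero {f : Fock} (hf : (f, 0) ∈ photonEnergyGraph)
    (h0 : inner ℂ vacuum f = 0) : f = 0 := by
  ext1
  funext n
  rcases n with _ | n
  · obtain ⟨c, hc⟩ := exists_smul_vacuumZero (f 0)
    rw [vacuum, lp.inner_single_left, hc] at h0
    have h1 : inner ℂ vacuumZero (c • vacuumZero) = c := by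
      rw [Submodule.coe_inner, Submodule.coe_smul, inner_smul_right, ← Submodule.coe_inner,
        inner_self_eq_norm_sq_to_K, vacuumZero_norm]
      simp
    have : c = 0 := h1.symm.trans h0
    rw [hc, this, zero_smul]; rfl
  · refine Subtype.ext (Lp.ext ?_)
    filter_upwards [mem_photonEnergyGraph.1 hf (n + 1), ae_zero_ne,
      Lp.coeFn_zero (Pol (n + 1)) 2 (volume : Measure (Fin (n + 1) → R3))] with k h1 h2 h3
    have e : ((0 : Fock) (n + 1) : NL2 (n + 1)) k = 0 := h3
    rw [e] at h1 ⊢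
    refine (smul_eq_zero.1 h1.symm).resolve_left fun h => ?_
    have h4 : (∑ l, ‖k l‖ : ℝ) = 0 := by exact_mod_cast h
    have h5 := (Finset.sum_eq_zero_iff_of_nonneg fun l _ => norm_nonneg (k l)).1 h4 0
      (Finset.mem_univ _)
    exact h2 (norm_eq_zero.1 h5)

lemma mem_photonEnergyInv_graph {f g : Fock} (hf : (f, g) ∈ photonEnergyGraph)
    (h0 : inner ℂ vacuum f = 0) : (g, f) ∈ photonEnergyInv.graph := by
  have hker : LinearMap.ker (photonEnergy.domRestrict (ℂ ∙ vacuum)ᗮ).toFun = ⊥ := by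
    refine LinearMap.ker_eq_bot'.2 fun y hy => ?_
    obtain ⟨y, hy1, hy2⟩ := y
    have e : photonEnergy ⟨y, hy2⟩ = 0 := by
      rw [← hy]
      exact (LinearPMap.domRestrict_apply (x := ⟨y, hy1, hy2⟩) (y := ⟨y, hy2⟩) rfl).symm
    have hm := photonEnergy.mem_graph ⟨y, hy2⟩
    rw [e, photonEnergy_graph] at hm
    exact Subtype.ext (eq_zero_of_photonEnergy_eq_zero hm
      ((Submodule.mem_orthogonal_singleton_iff_inner_right).1 hy1))
  rw [← photonEnergy_graph] at hf
  obtain ⟨x, hx, hx'⟩ := (LinearPMap.mem_graph_iff _).1 hf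
  simp only at hx hx'
  subst hx hx'
  have hx1 : (x : Fock) ∈ (ℂ ∙ vacuum)ᗮ :=
    Submodule.mem_orthogonal_singleton_iff_inner_right.2 h0
  have h := LinearPMap.mem_inverse_graph hker (x := ⟨x, hx1, x.2⟩)
  have e : photonEnergy.domRestrict (ℂ ∙ vacuum)ᗮ ⟨x, hx1, x.2⟩ = photonEnergy x :=
    LinearPMap.domRestrict_apply rfl
  rw [e] at h
  exact h

/-- The state `2^{-1/2} a*(V) Ψ₀`, with one photon. -/
def onePhotonState (V : onePhoton) : Fock :=
  (((Real.sqrt 2)⁻¹ : ℝ) : ℂ) • lp.single 2 1 (creation V 0 vacuumZero)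

lemma segal_vacuum (V : onePhoton) : (vacuum, onePhotonState V) ∈ segalGraph V := by
  refine mem_segalGraph.2 fun n => ?_
  have h1 : ∀ n, vacuum (n + 1) = 0 := fun n => lp.single_apply_ne _ _ _ (by simp)
  have h2 : annihilationPart V n vacuum = 0 := by
    change ContinuousLinearMap.adjoint (creation V n) (vacuum (n + 1)) = 0
    rw [h1, map_zero]
  rw [h2, zero_add, onePhotonState, lp.coeFn_smul, Pi.smul_apply]
  congr 1
  rcases n with _ | _ | n
  · exact lp.single_apply_ne _ _ _ (by simp)
  · rw [lp.single_apply_self]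
    change _ = creation V 0 (vacuum 0)
    rw [vacuum, lp.single_apply_self]
  · rw [lp.single_apply_ne _ _ _ (by simp)]
    change _ = creation V (n + 1) (vacuum (n + 1))
    rw [h1, map_zero]

lemma inner_vacuum_onePhotonState (V : onePhoton) : inner ℂ vacuum (onePhotonState V) = 0 := by
  rw [vacuum, lp.inner_single_left, onePhotonState, lp.coeFn_smul, Pi.smul_apply,
    lp.single_apply_ne _ _ _ (by simp), smul_zero, inner_zero_right]

lemma isEnergyMul_creation_zero {V W : onePhoton} (hVW : IsFrequencyMul V W) (h : nPhoton 0) :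
    IsEnergyMul (creation W 0 h : NL2 1) (creation V 0 h) := by
  rw [coe_creation, coe_creation]
  filter_upwards [Lp.coeFn_smul (((Real.sqrt ((0 : ℕ) + 1))⁻¹ : ℝ) : ℂ)
      (∑ l, insertL 0 W l (h : NL2 0)), Lp.coeFn_smul (((Real.sqrt ((0 : ℕ) + 1))⁻¹ : ℝ) : ℂ)
      (∑ l, insertL 0 V l (h : NL2 0)), coeFn_sum_insertL V 0 (h : NL2 0),
      coeFn_sum_insertL W 0 (h : NL2 0), (quasi_fst (0 : Fin 1)).ae hVW] with k h1 h2 h3 h4 h5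
  rw [h1, h2, Pi.smul_apply, Pi.smul_apply, h3, h4, smul_comm]
  congr 1
  simp only [Nat.reduceAdd, Finset.univ_unique, Fin.default_eq_zero, Fin.isValue,
    Finset.sum_singleton]
  ext a
  simp only [insertFun, h5, PiLp.smul_apply, smul_eq_mul, mul_assoc]

lemma single_mem_photonEnergyGraph {m : ℕ} {y z : nPhoton m} (h : IsEnergyMul (y : NL2 m) z) :
    ((lp.single 2 m y : Fock), (lp.single 2 m z : Fock)) ∈ photonEnergyGraph := by
  refine mem_photonEnergyGraph.2 fun n => ?_
  rcases eq_or_ne n m with rfl | hn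
  · rw [lp.single_apply_self, lp.single_apply_self]
    exact h
  · rw [lp.single_apply_ne _ _ _ hn, lp.single_apply_ne _ _ _ hn]
    filter_upwards [Lp.coeFn_zero (Pol n) 2 (volume : Measure (Fin n → R3))] with k h
    simp only [Submodule.coe_zero, h]
    simp

lemma energy_onePhotonState {V W : onePhoton} (hVW : IsFrequencyMul V W) :
    (onePhotonState W, onePhotonState V) ∈ photonEnergyGraph := by
  have h := single_mem_photonEnergyGraph (m := 1) (y := creation W 0 vacuumZero)
    (z := creation V 0 vacuumZero) (isEnergyMul_creation_zero hVW vacuumZero)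
  have h2 := photonEnergyGraph.smul_mem (((Real.sqrt 2)⁻¹ : ℝ) : ℂ) h
  rw [Prod.smul_mk] at h2
  rw [onePhotonState, onePhotonState]
  exact h2

/-! ### The coupling functions divided by the frequency -/

/-- `B_{m,x}(k) / |k|`, with the value `0` at `k = 0`. -/
def BDivFun (φ : 𝓢(ℝ, ℂ)) (m : Fin 3) (x : R3) (k : R3) : EuclideanSpace ℂ (Fin 3) :=
  ((‖k‖⁻¹ : ℝ) : ℂ) • BFun φ m x k

/-- `B_{m,x} / |k|` is square integrable: `|B_{m,x}(k) / k|² ≤ C |k|^{-2} (1 + |k|)^{-4}`, and in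
dimension three the Jacobian `r²` of polar coordinates cancels the singularity. -/
lemma memLp_BDivFun (φ : 𝓢(ℝ, ℂ)) (m : Fin 3) (x : R3) : MemLp (BDivFun φ m x) 2 volume := by
  obtain ⟨C, hC⟩ := norm_BFun_le φ m x
  have hm : AEStronglyMeasurable (BDivFun φ m x) (volume : Measure R3) := by
    have h1 := measurable_BFun φ m x
    have h2 : Measurable fun k : R3 => ((‖k‖⁻¹ : ℝ) : ℂ) := by fun_prop
    exact (h2.smul h1).aestronglyMeasurable
  rw [memLp_two_iff_integrable_sq_norm hm]
  have h4 : Integrable (fun k : R3 => C ^ 2 * (‖k‖⁻¹ ^ 2 * (1 + ‖k‖) ^ (-(4 : ℝ)))) volume := by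
    refine Integrable.const_mul ?_ _
    refine (integrable_fun_norm_addHaar volume
      (f := fun r : ℝ => r⁻¹ ^ 2 * (1 + r) ^ (-(4 : ℝ)))).2 ?_
    have h5 : Integrable (fun r : ℝ => (1 + ‖r‖) ^ (-(4 : ℝ))) volume :=
      integrable_one_add_norm (by simp)
    refine h5.integrableOn.congr_fun (fun r hr => ?_) measurableSet_Ioi
    have hr' : (0 : ℝ) < r := hr
    simp only [finrank_euclideanSpace, Fintype.card_fin, smul_eq_mul, Real.norm_of_nonneg hr'.le]
    field_simp
  refine h4.mono' (hm.norm.pow 2) (ae_of_all _ fun k => ?_)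
  have h0 : (0 : ℝ) < 1 + ‖k‖ := by positivity
  have e : ((1 + ‖k‖) ^ (-2 : ℝ)) ^ 2 = (1 + ‖k‖) ^ (-(4 : ℝ)) := by
    rw [← Real.rpow_natCast, ← Real.rpow_mul h0.le]; norm_num
  have h6 : ‖BFun φ m x k‖ ^ 2 ≤ C ^ 2 * (1 + ‖k‖) ^ (-(4 : ℝ)) := by
    rw [← e, ← mul_pow]
    exact pow_le_pow_left₀ (norm_nonneg _) (hC k) 2
  rw [Real.norm_of_nonneg (by positivity), BDivFun, norm_smul, Complex.norm_real, mul_pow,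
    Real.norm_of_nonneg (by positivity), mul_left_comm]
  gcongr

/-- `B_{m,x} / |k|` as an element of the one-photon space. -/
def BDivField (φ : 𝓢(ℝ, ℂ)) (m : Fin 3) (x : R3) : onePhoton :=
  ⟨(memLp_BDivFun φ m x).toLp _, by
    change ∀ᵐ k : R3, _
    have hB : ∀ᵐ k : R3, _ := (BField φ m x).2
    filter_upwards [(memLp_BDivFun φ m x).coeFn_toLp, (memLp_BFun φ m x).coeFn_toLp, hB]
      with k hk hk' h
    rw [hk]
    change ∑ j, (k j : ℂ) * ((memLp_BFun φ m x).toLp _ : Lp _ 2 _) k j = 0 at h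
    rw [hk'] at h
    simp only [BDivFun, PiLp.smul_apply, smul_eq_mul, mul_left_comm _ ((‖k‖⁻¹ : ℝ) : ℂ)]
    rw [← Finset.mul_sum, h, mul_zero]⟩

lemma isFrequencyMul_BField (φ : 𝓢(ℝ, ℂ)) (m : Fin 3) (x : R3) :
    IsFrequencyMul (BField φ m x) (BDivField φ m x) := by
  have h1 : ∀ᵐ k : R3, ((BField φ m x).1 : Lp (EuclideanSpace ℂ (Fin 3)) 2 (volume : Measure R3)) k = BFun φ m x k :=
    (memLp_BFun φ m x).coeFn_toLp
  have h2 : ∀ᵐ k : R3, ((BDivField φ m x).1 : Lp (EuclideanSpace ℂ (Fin 3)) 2 (volume : Measure R3)) k = BDivFun φ m x k :=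
    (memLp_BDivFun φ m x).coeFn_toLp
  filter_upwards [h1, h2, Measure.ae_ne (volume : Measure R3) 0] with k h1 h2 h3
  have h4 : ((‖k‖ : ℝ) : ℂ) ≠ 0 := by exact_mod_cast norm_ne_zero_iff.2 h3
  rw [h1, h2, BDivFun, smul_smul, Complex.ofReal_inv, mul_inv_cancel₀ h4, one_smul]

/-! ### Graphs of sums and tensor products of unbounded operators -/

section Graph

variable {E F : Type*} [AddCommGroup E] [Module ℂ E] [AddCommGroup F] [Module ℂ F]

lemma prodMk_sum_mem {ι : Type*} (G : Submodule ℂ (E × F)) (s : Finset ι) {a : ι → E} {b : ι → F}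
    (h : ∀ i, (a i, b i) ∈ G) : (∑ i ∈ s, a i, ∑ i ∈ s, b i) ∈ G := by
  convert G.sum_mem (t := s) (f := fun i => (a i, b i)) fun i _ => h i
  · simp [Prod.fst_sum]
  · simp [Prod.snd_sum]

lemma add_mem_graph {S T : E →ₗ.[ℂ] F} {f : E} {y z : F} (hS : (f, y) ∈ S.graph)
    (hT : (f, z) ∈ T.graph) : (f, y + z) ∈ (S + T).graph := by
  obtain ⟨a, ha, rfl⟩ := (LinearPMap.mem_graph_iff _).1 hS
  obtain ⟨b, hb, rfl⟩ := (LinearPMap.mem_graph_iff _).1 hT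
  simp only at ha hb ⊢
  subst ha
  refine (LinearPMap.mem_graph_iff _).2 ⟨⟨a, a.2, hb ▸ b.2⟩, rfl, ?_⟩
  rw [LinearPMap.add_apply]
  congr 2
  exact Subtype.ext hb.symm

lemma smul_mem_graph {T : E →ₗ.[ℂ] F} {f : E} {y : F} (c : ℂ) (h : (f, y) ∈ T.graph) :
    (f, c • y) ∈ (c • T).graph := by
  obtain ⟨a, ha, rfl⟩ := (LinearPMap.mem_graph_iff _).1 h
  exact (LinearPMap.mem_graph_iff _).2 ⟨a, ha, LinearPMap.smul_apply c T a⟩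

lemma sum_mem_graph {ι : Type*} (s : Finset ι) {T : ι → E →ₗ.[ℂ] F} {f : E} {y : ι → F}
    (h : ∀ i, (f, y i) ∈ (T i).graph) : (f, ∑ i ∈ s, y i) ∈ (∑ i ∈ s, T i).graph := by
  classical
  induction s using Finset.induction_on with
  | empty => exact (LinearPMap.mem_graph_iff _).2 ⟨⟨f, trivial⟩, rfl, rfl⟩
  | insert i s hi ih =>
    rw [Finset.sum_insert hi, Finset.sum_insert hi]
    exact add_mem_graph (h i) ih

end Graph

variable {P : ℕ}

lemma value_eq {T : Htot P →ₗ.[ℂ] Htot P} {f y : Htot P} (h : (f, y) ∈ T.graph) :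
    value T f = y := by
  have hf := LinearPMap.mem_domain_of_mem_graph h
  rw [value, dif_pos hf]
  exact LinearPMap.mem_graph_snd_inj T (T.mem_graph ⟨f, hf⟩) h rfl

lemma mem_opTensor_graph {T : Fock →ₗ.[ℂ] Fock}
    (S : Matrix (Fin P → Fin 2) (Fin P → Fin 2) ℂ) {f : Htot P} {y : (Fin P → Fin 2) → Fock}
    (h : ∀ t, (f t, y t) ∈ T.graph) :
    (f, (WithLp.toLp 2 fun s => ∑ t, S s t • y t : Htot P)) ∈ (opTensor T S).graph := by
  have hd : ∀ t, f t ∈ T.domain := fun t => LinearPMap.mem_domain_of_mem_graph (h t)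
  refine (LinearPMap.mem_graph_iff _).2 ⟨⟨f, hd⟩, rfl, ?_⟩
  ext1 s
  refine Finset.sum_congr rfl fun t _ => ?_
  congr 1
  exact LinearPMap.mem_graph_snd_inj T (T.mem_graph ⟨f t, hd t⟩) (h t) rfl

lemma mem_opTensor_one_graph {T : Fock →ₗ.[ℂ] Fock} {f g : Htot P} :
    (f, g) ∈ (opTensor T 1 : Htot P →ₗ.[ℂ] Htot P).graph ↔ ∀ s, (f s, g s) ∈ T.graph := by
  have key : ∀ y : (Fin P → Fin 2) → Fock,
      (WithLp.toLp 2 fun s => ∑ t, (1 : Matrix _ _ ℂ) s t • y t : Htot P) = WithLp.toLp 2 y := by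
    intro y
    ext1 s
    simp [Matrix.one_apply]
  constructor
  · intro h s
    have hd : ∀ t, f t ∈ T.domain := LinearPMap.mem_domain_of_mem_graph h
    have h2 := mem_opTensor_graph 1 fun t => T.mem_graph ⟨f t, hd t⟩
    rw [key] at h2
    rw [LinearPMap.mem_graph_snd_inj _ h h2 rfl]
    exact T.mem_graph ⟨f s, hd s⟩
  · intro h
    have h2 := mem_opTensor_graph 1 h
    rwa [key] at h2

lemma mem_freeHamiltonian_graph {f g : Htot P} :
    (f, g) ∈ (freeHamiltonian P).graph ↔ ∀ s, (f s, g s) ∈ photonEnergyGraph := by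
  rw [freeHamiltonian, mem_opTensor_one_graph, photonEnergy_graph]

lemma domainNorm_eq {f f' : Htot P} (h : (f, f') ∈ (freeHamiltonian P).graph)
    (hd : f ∈ (freeHamiltonian P).domain) :
    domainNorm ⟨f, hd⟩ = Real.sqrt (‖f'‖ ^ 2 + ‖f‖ ^ 2) := by
  have : freeHamiltonian P ⟨f, hd⟩ = f' :=
    LinearPMap.mem_graph_snd_inj _ ((freeHamiltonian P).mem_graph ⟨f, hd⟩) h rfl
  rw [domainNorm, this]

lemma freeHamiltonian_symm {f f' g g' : Htot P} (hf : (f, f') ∈ (freeHamiltonian P).graph)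
    (hg : (g, g') ∈ (freeHamiltonian P).graph) : inner ℂ f' g = inner ℂ f g' := by
  rw [PiLp.inner_apply, PiLp.inner_apply]
  exact Finset.sum_congr rfl fun s _ =>
    photonEnergy_symm (mem_freeHamiltonian_graph.1 hf s) (mem_freeHamiltonian_graph.1 hg s)

lemma freeHamiltonian_nonneg {f f' : Htot P} (hf : (f, f') ∈ (freeHamiltonian P).graph) :
    0 ≤ (inner ℂ f' f).re := by
  rw [PiLp.inner_apply, Complex.re_sum]
  exact Finset.sum_nonneg fun s _ => photonEnergy_nonneg (mem_freeHamiltonian_graph.1 hf s)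

/-! ### The interaction on the domain of the free Hamiltonian -/

lemma isHermitian_spinMatrix (m : Fin 3) (lam : Fin P) : (spinMatrix m lam).IsHermitian := by
  have h : ∀ i j, star (pauli m i j) = pauli m j i := by
    intro i j
    fin_cases m <;> fin_cases i <;> fin_cases j <;> simp [pauli]
  ext s t
  simp only [Matrix.conjTranspose_apply, spinMatrix, Matrix.of_apply, star_prod]
  refine Finset.prod_congr rfl fun μ _ => ?_
  split_ifs
  · exact h _ _
  · rw [Matrix.one_apply, Matrix.one_apply]
    split_ifs with h1 h2 h2 <;> simp_all

lemma norm_sq_apply_le {ι : Type*} [Fintype ι] {f : PiLp 2 fun _ : ι => Fock} (i : ι) :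
    ‖f i‖ ^ 2 ≤ ‖f‖ ^ 2 := by
  gcongr
  exact PiLp.norm_apply_le f i

/-- `Φ_S(V) ⊗ S` is bounded relative to `H_ph ⊗ I`, if `V = |k| W`. -/
lemma exists_segal_tensor {V W : onePhoton} (hVW : IsFrequencyMul V W)
    (S : Matrix (Fin P → Fin 2) (Fin P → Fin 2) ℂ) :
    ∃ c : ℝ, 0 ≤ c ∧ ∀ f f' : Htot P, (f, f') ∈ (freeHamiltonian P).graph →
      ∃ y, (f, y) ∈ (opTensor (segalField V) S).graph ∧
        ‖y‖ ≤ c * Real.sqrt (‖f'‖ ^ 2 + ‖f‖ ^ 2) := by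
  have hb : 0 ≤ segalBound V W := by unfold segalBound; positivity
  refine ⟨∑ s, ∑ t, ‖S s t‖ * Real.sqrt (segalBound V W), by positivity, fun f f' hf => ?_⟩
  choose z hz hz' using fun t => exists_segal hVW (mem_freeHamiltonian_graph.1 hf t)
  have hz2 : ∀ t, ‖z t‖ ≤ Real.sqrt (segalBound V W) * Real.sqrt (‖f'‖ ^ 2 + ‖f‖ ^ 2) := by
    intro t
    rw [← Real.sqrt_mul hb]
    refine Real.le_sqrt_of_sq_le ((hz' t).trans ?_)
    have h1 := norm_sq_apply_le (f := f) t
    have h2 := norm_sq_apply_le (f := f') t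
    gcongr
  refine ⟨_, mem_opTensor_graph S fun t => by rw [segalField_graph]; exact hz t, ?_⟩
  have h1 : ∀ y : Htot P, ‖y‖ ≤ ∑ s, ‖y s‖ := by
    intro y
    rw [PiLp.norm_eq_of_L2]
    refine Real.sqrt_le_iff.2 ⟨by positivity, ?_⟩
    exact Finset.sum_sq_le_sq_sum_of_nonneg fun s _ => norm_nonneg _
  refine (h1 _).trans ?_
  rw [Finset.sum_mul]
  refine Finset.sum_le_sum fun s _ => ?_
  refine (norm_sum_le _ _).trans ?_
  rw [Finset.sum_mul]
  refine Finset.sum_le_sum fun t _ => ?_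
  rw [norm_smul, mul_assoc]
  gcongr
  exact hz2 t

lemma segal_tensor_symm {V W : onePhoton} (hVW : IsFrequencyMul V W)
    {S : Matrix (Fin P → Fin 2) (Fin P → Fin 2) ℂ} (hS : S.IsHermitian) {f f' g g' y z : Htot P}
    (hf : (f, f') ∈ (freeHamiltonian P).graph) (hg : (g, g') ∈ (freeHamiltonian P).graph)
    (hy : (f, y) ∈ (opTensor (segalField V) S).graph)
    (hz : (g, z) ∈ (opTensor (segalField V) S).graph) : inner ℂ y g = inner ℂ f z := by
  choose a ha ha' using fun t => exists_segal hVW (mem_freeHamiltonian_graph.1 hf t)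
  choose b hb hb' using fun t => exists_segal hVW (mem_freeHamiltonian_graph.1 hg t)
  have e1 := LinearPMap.mem_graph_snd_inj _ hy
    (mem_opTensor_graph S fun t => by rw [segalField_graph]; exact ha t) rfl
  have e2 := LinearPMap.mem_graph_snd_inj _ hz
    (mem_opTensor_graph S fun t => by rw [segalField_graph]; exact hb t) rfl
  rw [e1, e2, PiLp.inner_apply, PiLp.inner_apply]
  simp only [sum_inner, inner_sum, inner_smul_left, inner_smul_right]
  rw [Finset.sum_comm]
  refine Finset.sum_congr rfl fun s _ => Finset.sum_congr rfl fun t _ => ?_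
  rw [segal_symm hVW (mem_freeHamiltonian_graph.1 hf s) (mem_freeHamiltonian_graph.1 hg t)
    (ha s) (hb t)]
  congr 1
  exact hS.apply s t

lemma mem_interaction_graph (φ : 𝓢(ℝ, ℂ)) (x : Fin P → R3) (M : EuclideanSpace ℝ (Fin P))
    {f : Htot P} {y : Fin P → Fin 3 → Htot P}
    (h : ∀ lam m, (f, y lam m)
      ∈ (opTensor (segalField (BField φ m (x lam))) (spinMatrix m lam)).graph) :
    (f, ∑ lam, ∑ m, (M lam : ℂ) • y lam m) ∈ (interaction φ x M).graph :=
  sum_mem_graph _ fun lam => sum_mem_graph _ fun m => smul_mem_graph _ (h lam m)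

lemma norm_ofReal_apply_le (M : EuclideanSpace ℝ (Fin P)) (lam : Fin P) : ‖(M lam : ℂ)‖ ≤ ‖M‖ := by
  rw [Complex.norm_real]
  exact PiLp.norm_apply_le M lam

lemma exists_interaction (φ : 𝓢(ℝ, ℂ)) (x : Fin P → R3) :
    ∃ C : ℝ, 0 < C ∧ ∀ (M : EuclideanSpace ℝ (Fin P)) (f f' : Htot P),
      (f, f') ∈ (freeHamiltonian P).graph → ∃ y, (f, y) ∈ (interaction φ x M).graph ∧
        ‖y‖ ≤ C * ‖M‖ * Real.sqrt (‖f'‖ ^ 2 + ‖f‖ ^ 2) := by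
  choose c hc hc' using fun (lam : Fin P) (m : Fin 3) =>
    exists_segal_tensor (isFrequencyMul_BField φ m (x lam)) (spinMatrix m lam)
  refine ⟨∑ lam, ∑ m, c lam m + 1,
    add_pos_of_nonneg_of_pos (Finset.sum_nonneg fun lam _ => Finset.sum_nonneg fun m _ => hc lam m)
      one_pos, fun M f f' hf => ?_⟩
  choose y hy hy' using fun lam m => hc' lam m f f' hf
  refine ⟨_, mem_interaction_graph φ x M hy, ?_⟩
  set d := Real.sqrt (‖f'‖ ^ 2 + ‖f‖ ^ 2)
  have hd : 0 ≤ d := Real.sqrt_nonneg _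
  calc ‖∑ lam, ∑ m, (M lam : ℂ) • y lam m‖
      ≤ ∑ lam, ∑ m, ‖M‖ * (c lam m * d) := by
        refine (norm_sum_le _ _).trans (Finset.sum_le_sum fun lam _ => ?_)
        refine (norm_sum_le _ _).trans (Finset.sum_le_sum fun m _ => ?_)
        rw [norm_smul]
        exact mul_le_mul (norm_ofReal_apply_le M lam) (hy' lam m) (norm_nonneg _) (norm_nonneg _)
    _ = (∑ lam, ∑ m, c lam m) * ‖M‖ * d := by
        simp only [← Finset.mul_sum, ← Finset.sum_mul]
        ring
    _ ≤ _ := by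
        gcongr
        linarith

lemma interaction_symm (φ : 𝓢(ℝ, ℂ)) (x : Fin P → R3) (M : EuclideanSpace ℝ (Fin P))
    {f f' g g' y z : Htot P}
    (hf : (f, f') ∈ (freeHamiltonian P).graph) (hg : (g, g') ∈ (freeHamiltonian P).graph)
    (hy : (f, y) ∈ (interaction φ x M).graph) (hz : (g, z) ∈ (interaction φ x M).graph) :
    inner ℂ y g = inner ℂ f z := by
  choose c hc hc' using fun (lam : Fin P) (m : Fin 3) =>
    exists_segal_tensor (isFrequencyMul_BField φ m (x lam)) (spinMatrix m lam)
  choose a ha ha' using fun lam m => hc' lam m f f' hf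
  choose b hb hb' using fun lam m => hc' lam m g g' hg
  rw [LinearPMap.mem_graph_snd_inj _ hy (mem_interaction_graph φ x M ha) rfl,
    LinearPMap.mem_graph_snd_inj _ hz (mem_interaction_graph φ x M hb) rfl]
  simp only [sum_inner, inner_sum, inner_smul_left, inner_smul_right, Complex.conj_ofReal]
  refine Finset.sum_congr rfl fun lam _ => Finset.sum_congr rfl fun m _ => ?_
  rw [segal_tensor_symm (isFrequencyMul_BField φ m (x lam)) (isHermitian_spinMatrix m lam)
    hf hg (ha lam m) (hb lam m)]

lemma hamiltonian_domain (φ : 𝓢(ℝ, ℂ)) (x : Fin P → R3) (M : EuclideanSpace ℝ (Fin P)) :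
    (hamiltonian φ x M).domain = (freeHamiltonian P).domain := by
  obtain ⟨C, -, hC⟩ := exists_interaction φ x
  refine inf_eq_left.2 fun f hf => ?_
  obtain ⟨y, hy, -⟩ := hC M f _ ((freeHamiltonian P).mem_graph ⟨f, hf⟩)
  exact LinearPMap.mem_domain_of_mem_graph hy

/-! ### The corrector -/

/-- `y ⊗ S X`, for a Fock space vector `y`, a spin matrix `S` and a spin state `X`. -/
def spinVec (S : Matrix (Fin P → Fin 2) (Fin P → Fin 2) ℂ) (y : Fock) : Hsp P →L[ℂ] Htot P :=
  LinearMap.toContinuousLinearMap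
    { toFun := fun X => WithLp.toLp 2 fun s => ∑ t, S s t • X t • y
      map_add' := by
        intro X Y
        ext1 s
        simp [add_smul, Finset.sum_add_distrib]
      map_smul' := by
        intro c X
        ext1 s
        simp only [PiLp.smul_apply, RingHom.id_apply, Finset.smul_sum, smul_eq_mul, mul_smul,
          smul_comm c] }

lemma spinVec_apply (S : Matrix (Fin P → Fin 2) (Fin P → Fin 2) ℂ) (y : Fock) (X : Hsp P) :
    spinVec S y X = WithLp.toLp 2 fun s => ∑ t, S s t • X t • y := rfl

lemma vacuumEmbedding_apply (X : Hsp P) (s : Fin P → Fin 2) :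
    vacuumEmbedding P X s = X s • vacuum := rfl

/-- `∑_lam ∑_m M^{[lam]} y_{m, lam} ⊗ σ_m^{[lam]} X`, for given Fock space vectors `y_{m, lam}`. -/
def dipoleVector (y : Fin 3 → Fin P → Fock) (M : EuclideanSpace ℝ (Fin P)) (X : Hsp P) : Htot P :=
  ∑ lam, ∑ m, (M lam : ℂ) • spinVec (spinMatrix m lam) (y m lam) X

lemma dipoleVector_add (y : Fin 3 → Fin P → Fock) (M N : EuclideanSpace ℝ (Fin P)) (X : Hsp P) :
    dipoleVector y (M + N) X = dipoleVector y M X + dipoleVector y N X := by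
  simp [dipoleVector, add_smul, Finset.sum_add_distrib]

lemma dipoleVector_smul (y : Fin 3 → Fin P → Fock) (c : ℝ) (M : EuclideanSpace ℝ (Fin P))
    (X : Hsp P) : dipoleVector y (c • M) X = (c : ℂ) • dipoleVector y M X := by
  simp [dipoleVector, mul_smul, Finset.smul_sum]

lemma exists_norm_dipoleVector_le (y : Fin 3 → Fin P → Fock) : ∃ c : ℝ, 0 ≤ c ∧
    ∀ M X, ‖dipoleVector y M X‖ ≤ c * ‖M‖ * ‖X‖ := by
  refine ⟨∑ lam, ∑ m, ‖spinVec (spinMatrix m lam) (y m lam)‖, by positivity, fun M X => ?_⟩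
  calc ‖dipoleVector y M X‖
      ≤ ∑ lam, ∑ m, ‖M‖ * (‖spinVec (spinMatrix m lam) (y m lam)‖ * ‖X‖) := by
        refine (norm_sum_le _ _).trans (Finset.sum_le_sum fun lam _ => ?_)
        refine (norm_sum_le _ _).trans (Finset.sum_le_sum fun m _ => ?_)
        rw [norm_smul]
        exact mul_le_mul (norm_ofReal_apply_le M lam) (ContinuousLinearMap.le_opNorm _ _)
          (norm_nonneg _) (norm_nonneg _)
    _ = _ := by
        simp only [← Finset.mul_sum, ← Finset.sum_mul]
        ring

lemma dipoleVector_mem_graph {T : Fock →ₗ.[ℂ] Fock} {y z : Fin 3 → Fin P → Fock}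
    (h : ∀ m lam, (y m lam, z m lam) ∈ T.graph) (M : EuclideanSpace ℝ (Fin P)) (X : Hsp P) :
    (dipoleVector y M X, dipoleVector z M X)
      ∈ (opTensor T 1 : Htot P →ₗ.[ℂ] Htot P).graph := by
  refine prodMk_sum_mem _ _ fun lam => prodMk_sum_mem _ _ fun m => ?_
  refine Submodule.smul_mem _ (M lam : ℂ)
    (x := (spinVec (spinMatrix m lam) (y m lam) X, spinVec (spinMatrix m lam) (z m lam) X)) ?_
  refine mem_opTensor_one_graph.2 fun s => ?_
  refine prodMk_sum_mem _ _ fun t => ?_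
  exact Submodule.smul_mem _ (spinMatrix m lam s t) (Submodule.smul_mem _ (X t) (h m lam))

lemma inner_dipoleVector_vacuumEmbedding {y : Fin 3 → Fin P → Fock}
    (h : ∀ m lam, inner ℂ (y m lam) vacuum = 0) (M : EuclideanSpace ℝ (Fin P)) (X Y : Hsp P) :
    inner ℂ (dipoleVector y M X) (vacuumEmbedding P Y) = 0 := by
  simp [dipoleVector, sum_inner, inner_smul_left, PiLp.inner_apply, spinVec_apply,
    vacuumEmbedding_apply, inner_smul_right, h]

lemma vacuumEmbedding_mem_graph (X : Hsp P) :
    (vacuumEmbedding P X, 0) ∈ (freeHamiltonian P).graph := by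
  refine mem_freeHamiltonian_graph.2 fun s => ?_
  have h := photonEnergyGraph.smul_mem (X s) vacuum_mem
  rwa [Prod.smul_mk, smul_zero] at h

/-- The value of `H_int(M)` at `Ψ₀ ⊗ X`. -/
def interactionVacuum (φ : 𝓢(ℝ, ℂ)) (x : Fin P → R3) (M : EuclideanSpace ℝ (Fin P)) (X : Hsp P) :
    Htot P :=
  dipoleVector (fun m lam => onePhotonState (BField φ m (x lam))) M X

/-- The explicit form of the corrector `u_M(X)`: it is obtained from `H_int(M) (Ψ₀ ⊗ X)` by
dividing the coupling functions by `|k|`. -/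
def explicitCorrector (φ : 𝓢(ℝ, ℂ)) (x : Fin P → R3) (M : EuclideanSpace ℝ (Fin P)) (X : Hsp P) :
    Htot P :=
  dipoleVector (fun m lam => onePhotonState (BDivField φ m (x lam))) M X

section

variable (φ : 𝓢(ℝ, ℂ)) (x : Fin P → R3) (M : EuclideanSpace ℝ (Fin P)) (X : Hsp P)

lemma interaction_vacuumEmbedding :
    (vacuumEmbedding P X, interactionVacuum φ x M X) ∈ (interaction φ x M).graph := by
  refine mem_interaction_graph φ x M fun lam m => ?_
  refine mem_opTensor_graph (y := fun t => X t • onePhotonState (BField φ m (x lam)))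
    (spinMatrix m lam) fun t => ?_
  rw [segalField_graph]
  exact Submodule.smul_mem _ (X t) (segal_vacuum (BField φ m (x lam)))

lemma freeHamiltonian_explicitCorrector :
    (explicitCorrector φ x M X, interactionVacuum φ x M X) ∈ (freeHamiltonian P).graph :=
  dipoleVector_mem_graph (fun m lam => by
    rw [photonEnergy_graph]
    exact energy_onePhotonState (isFrequencyMul_BField φ m (x lam))) M X

lemma photonEnergyInv_interactionVacuum :
    (interactionVacuum φ x M X, explicitCorrector φ x M X)
      ∈ (opTensor photonEnergyInv 1 : Htot P →ₗ.[ℂ] Htot P).graph :=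
  dipoleVector_mem_graph (fun m lam => mem_photonEnergyInv_graph
    (energy_onePhotonState (isFrequencyMul_BField φ m (x lam))) (inner_vacuum_onePhotonState _)) M X

lemma value_interaction_vacuumEmbedding :
    value (interaction φ x M) (vacuumEmbedding P X) = interactionVacuum φ x M X :=
  value_eq (interaction_vacuumEmbedding φ x M X)

lemma corrector_eq : corrector φ x M X = explicitCorrector φ x M X := by
  rw [corrector, value_interaction_vacuumEmbedding]
  exact value_eq (photonEnergyInv_interactionVacuum φ x M X)

lemma aOpDefined : AOpDefined φ x M X := by
  refine ⟨LinearPMap.mem_domain_of_mem_graph (interaction_vacuumEmbedding φ x M X), ?_, ?_⟩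
  · rw [value_interaction_vacuumEmbedding]
    exact LinearPMap.mem_domain_of_mem_graph (photonEnergyInv_interactionVacuum φ x M X)
  · rw [corrector_eq]
    obtain ⟨C, -, hC⟩ := exists_interaction φ x
    obtain ⟨y, hy, -⟩ := hC M _ _ (freeHamiltonian_explicitCorrector φ x M X)
    exact LinearPMap.mem_domain_of_mem_graph hy

lemma exists_isCorrectorBound : ∃ K : ℝ, 0 < K ∧ IsCorrectorBound φ x K := by
  obtain ⟨a, ha, ha'⟩ := exists_norm_dipoleVector_le
    fun m lam => onePhotonState (BField φ m (x lam))
  obtain ⟨b, hb, hb'⟩ := exists_norm_dipoleVector_le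
    fun m lam => onePhotonState (BDivField φ m (x lam))
  refine ⟨a + b + 1, by positivity, fun M X => ?_⟩
  have hg := freeHamiltonian_explicitCorrector φ x M X
  rw [corrector_eq]
  refine ⟨LinearPMap.mem_domain_of_mem_graph hg, ?_⟩
  rw [domainNorm_eq hg]
  have h1 : ‖interactionVacuum φ x M X‖ ≤ a * ‖M‖ * ‖X‖ := ha' M X
  have h2 : ‖explicitCorrector φ x M X‖ ≤ b * ‖M‖ * ‖X‖ := hb' M X
  refine Real.sqrt_le_iff.2 ⟨by positivity, ?_⟩
  have h3 : a * ‖M‖ * ‖X‖ + b * ‖M‖ * ‖X‖ ≤ (a + b + 1) * ‖M‖ * ‖X‖ := by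
    have : 0 ≤ ‖M‖ * ‖X‖ := by positivity
    nlinarith
  nlinarith [norm_nonneg (interactionVacuum φ x M X), norm_nonneg (explicitCorrector φ x M X)]

/-- `⟨A_M X, X⟩ = -⟨u_M(X), H_int(M) (Ψ₀ ⊗ X)⟩`, which is real as `H_int(M) (Ψ₀ ⊗ X) = H_ph u_M(X)`
and `H_ph` is symmetric. -/
lemma inner_AOp : inner ℂ (AOp φ x M X) X
    = ((-(inner ℂ (interactionVacuum φ x M X) (explicitCorrector φ x M X)).re : ℝ) : ℂ) := by
  obtain ⟨C, -, hC⟩ := exists_interaction φ x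
  have hu := freeHamiltonian_explicitCorrector φ x M X
  obtain ⟨y, hy, -⟩ := hC M _ _ hu
  rw [AOp, corrector_eq, value_eq hy, inner_neg_left, ContinuousLinearMap.adjoint_inner_left,
    interaction_symm φ x M hu (vacuumEmbedding_mem_graph X) hy
      (interaction_vacuumEmbedding φ x M X), ← freeHamiltonian_symm hu hu, Complex.ofReal_neg]
  congr 1
  refine (Complex.conj_eq_iff_re.1 ?_).symm
  rw [inner_conj_symm, freeHamiltonian_symm hu hu]

/-! ### The energy near the vacuum -/

variable {M X}

/-- Completing the square: with `w = H_int(M) (Ψ₀ ⊗ X) = H_ph u`,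
`⟨H(M) (Ψ₀ ⊗ X + h), Ψ₀ ⊗ X + h⟩ = ⟨H_ph (h + u), h + u⟩ - ⟨H_ph u, u⟩ + ⟨H_int(M) h, h⟩`. -/
lemma inner_energy {h h' y : Htot P} (hh : (h, h') ∈ (freeHamiltonian P).graph)
    (hy : (h, y) ∈ (interaction φ x M).graph) :
    inner ℂ (h' + (interactionVacuum φ x M X + y)) (vacuumEmbedding P X + h)
      = inner ℂ (h' + interactionVacuum φ x M X) (h + explicitCorrector φ x M X)
        - inner ℂ (interactionVacuum φ x M X) (explicitCorrector φ x M X) + inner ℂ y h := by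
  have hE := vacuumEmbedding_mem_graph X
  have h1 : inner ℂ h' (vacuumEmbedding P X) = 0 := by
    rw [freeHamiltonian_symm hh hE, inner_zero_right]
  have h2 : inner ℂ (interactionVacuum φ x M X) (vacuumEmbedding P X) = 0 :=
    inner_dipoleVector_vacuumEmbedding (fun m lam => by
      rw [← inner_conj_symm, inner_vacuum_onePhotonState, map_zero]) M X X
  have h3 : inner ℂ y (vacuumEmbedding P X) = inner ℂ h (interactionVacuum φ x M X) :=
    interaction_symm φ x M hh hE hy (interaction_vacuumEmbedding φ x M X)
  have h4 : inner ℂ h' (explicitCorrector φ x M X) = inner ℂ h (interactionVacuum φ x M X) :=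
    freeHamiltonian_symm hh (freeHamiltonian_explicitCorrector φ x M X)
  simp only [inner_add_left, inner_add_right, h1, h2, h3, h4]
  ring

lemma mem_hamiltonian_graph {h h' y : Htot P} (hh : (h, h') ∈ (freeHamiltonian P).graph)
    (hy : (h, y) ∈ (interaction φ x M).graph) :
    (vacuumEmbedding P X + h, h' + (interactionVacuum φ x M X + y))
      ∈ (hamiltonian φ x M).graph := by
  have h1 := Submodule.add_mem _ (vacuumEmbedding_mem_graph X) hh
  have h2 := Submodule.add_mem _ (interaction_vacuumEmbedding φ x M X) hy
  rw [Prod.mk_add_mk, zero_add] at h1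
  exact add_mem_graph h1 h2

lemma norm_mul_norm_le {C r : ℝ} {h h' y : Htot P} (hC : 0 < C)
    (hd : Real.sqrt (‖h'‖ ^ 2 + ‖h‖ ^ 2) ≤ r * ‖X‖)
    (hy : ‖y‖ ≤ C * ‖M‖ * Real.sqrt (‖h'‖ ^ 2 + ‖h‖ ^ 2)) :
    ‖y‖ * ‖h‖ ≤ C * ‖M‖ * r ^ 2 * ‖X‖ ^ 2 := by
  have h1 : ‖h‖ ≤ r * ‖X‖ :=
    (Real.le_sqrt_of_sq_le (by nlinarith [sq_nonneg ‖h'‖])).trans hd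
  have h2 : ‖y‖ ≤ C * ‖M‖ * (r * ‖X‖) := hy.trans (by gcongr)
  calc ‖y‖ * ‖h‖ ≤ C * ‖M‖ * (r * ‖X‖) * (r * ‖X‖) := by
        refine mul_le_mul h2 h1 (norm_nonneg _) ((norm_nonneg _).trans h2)
    _ = _ := by ring

/-- The energies in the ball of radius `r` are at least `-⟨H_ph u, u⟩`, up to the error
`C |M| r² |X|²` caused by `⟨H_int(M) h, h⟩`. -/
lemma le_of_mem_ballEnergies {C : ℝ} (hC0 : 0 < C)
    (hC : ∀ (f f' : Htot P), (f, f') ∈ (freeHamiltonian P).graph →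
      ∃ y, (f, y) ∈ (interaction φ x M).graph ∧
        ‖y‖ ≤ C * ‖M‖ * Real.sqrt (‖f'‖ ^ 2 + ‖f‖ ^ 2)) {r e : ℝ}
    (he : e ∈ ballEnergies φ x M r X) :
    -(inner ℂ (interactionVacuum φ x M X) (explicitCorrector φ x M X)).re
      - C * ‖M‖ * r ^ 2 * ‖X‖ ^ 2 ≤ e := by
  obtain ⟨f, ⟨-, hd, hr⟩, rfl⟩ := he
  set h := (f : Htot P) - vacuumEmbedding P X with hdef
  have hh := (freeHamiltonian P).mem_graph ⟨h, hd⟩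
  obtain ⟨y, hy, hy'⟩ := hC _ _ hh
  simp only at hy hh
  rw [domainNorm_eq hh] at hr
  have ef : (f : Htot P) = vacuumEmbedding P X + h := by rw [hdef]; abel
  have e1 := LinearPMap.mem_graph_snd_inj _ ((hamiltonian φ x M).mem_graph f)
    (mem_hamiltonian_graph φ x (X := X) hh hy) ef
  rw [e1, ef, inner_energy φ x hh hy, Complex.add_re, Complex.sub_re]
  have h1 := freeHamiltonian_nonneg
    (Submodule.add_mem _ hh (freeHamiltonian_explicitCorrector φ x M X))
  have h2 := norm_mul_norm_le hC0 hr hy'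
  have h3 := (abs_le.1 ((Complex.abs_re_le_norm _).trans (norm_inner_le_norm (𝕜 := ℂ) y h))).1
  linarith

/-- The trial state `Ψ₀ ⊗ X - u_M(X)`. -/
lemma exists_mem_ballEnergies {C : ℝ} (hC0 : 0 < C)
    (hC : ∀ (f f' : Htot P), (f, f') ∈ (freeHamiltonian P).graph →
      ∃ y, (f, y) ∈ (interaction φ x M).graph ∧
        ‖y‖ ≤ C * ‖M‖ * Real.sqrt (‖f'‖ ^ 2 + ‖f‖ ^ 2)) {r : ℝ}
    (hr : ∃ h : corrector φ x M X ∈ (freeHamiltonian P).domain, domainNorm ⟨_, h⟩ ≤ r * ‖X‖) :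
    ∃ e ∈ ballEnergies φ x M r X,
      e ≤ -(inner ℂ (interactionVacuum φ x M X) (explicitCorrector φ x M X)).re
        + C * ‖M‖ * r ^ 2 * ‖X‖ ^ 2 := by
  obtain ⟨hd, hr⟩ := hr
  have hu := freeHamiltonian_explicitCorrector φ x M X
  have hg : (corrector φ x M X, interactionVacuum φ x M X) ∈ (freeHamiltonian P).graph := by
    rwa [corrector_eq]
  rw [domainNorm_eq hg, corrector_eq] at hr
  have hh := Submodule.neg_mem _ hu
  rw [Prod.neg_mk] at hh
  obtain ⟨y, hy, hy'⟩ := hC _ _ hh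
  have hH := mem_hamiltonian_graph φ x (X := X) hh hy
  have hHd := LinearPMap.mem_domain_of_mem_graph hH
  have hr' : Real.sqrt (‖-interactionVacuum φ x M X‖ ^ 2 + ‖-explicitCorrector φ x M X‖ ^ 2)
      ≤ r * ‖X‖ := by rwa [norm_neg, norm_neg]
  have hd2 : vacuumEmbedding P X + -explicitCorrector φ x M X - vacuumEmbedding P X
      = -explicitCorrector φ x M X := by abel
  refine ⟨_, ⟨⟨_, hHd⟩, ⟨by rwa [hamiltonian_domain] at hHd, ?_⟩, rfl⟩, ?_⟩
  · simp only [hd2]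
    refine ⟨LinearPMap.mem_domain_of_mem_graph hh, ?_⟩
    rwa [domainNorm_eq hh]
  · have e1 := LinearPMap.mem_graph_snd_inj _ ((hamiltonian φ x M).mem_graph ⟨_, hHd⟩) hH rfl
    rw [e1]
    simp only
    rw [inner_energy φ x hh hy, neg_add_cancel, inner_zero_left, zero_sub, Complex.add_re,
      Complex.neg_re]
    have h2 := norm_mul_norm_le hC0 hr' hy'
    have h3 := (abs_le.1 ((Complex.abs_re_le_norm _).trans
      (norm_inner_le_norm (𝕜 := ℂ) y (-explicitCorrector φ x M X)))).2
    linarith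

variable (X) in
/-- The real quadratic form `M ↦ -⟨H_int(M) (Ψ₀ ⊗ X), u_M(X)⟩`. -/
def energyForm : QuadraticForm ℝ (EuclideanSpace ℝ (Fin P)) :=
  LinearMap.BilinMap.toQuadraticMap (LinearMap.mk₂ ℝ
    (fun M N => -(inner ℂ (interactionVacuum φ x M X) (explicitCorrector φ x N X)).re)
    (fun M M' N => by
      rw [interactionVacuum, dipoleVector_add, inner_add_left, Complex.add_re, neg_add]
      rfl)
    (fun c M N => by
      rw [interactionVacuum, dipoleVector_smul, inner_smul_left, Complex.conj_ofReal,
        Complex.re_ofReal_mul, smul_eq_mul, mul_neg]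
      rfl)
    (fun M N N' => by
      rw [explicitCorrector, dipoleVector_add, inner_add_right, Complex.add_re, neg_add]
      rfl)
    (fun c M N => by
      rw [explicitCorrector, dipoleVector_smul, inner_smul_right,
        Complex.re_ofReal_mul, smul_eq_mul, mul_neg]
      rfl))

variable (M X) in
lemma energyForm_eq : ((energyForm φ x X M : ℝ) : ℂ) = inner ℂ (AOp φ x M X) X :=
  (inner_AOp φ x M X).symm

lemma exists_energy_bound : ∃ C : ℝ, 0 < C ∧ ∀ K : ℝ, 0 < K → IsCorrectorBound φ x K →
    ∀ ρ : ℝ, K ≤ ρ → ∀ (M : EuclideanSpace ℝ (Fin P)) (X : Hsp P),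
      IsGLB (ballEnergies φ x M (ρ * ‖M‖) X) (infEnergy φ x M (ρ * ‖M‖) X) ∧
      |infEnergy φ x M (ρ * ‖M‖) X - energyForm φ x X M| ≤ C * ρ ^ 2 * ‖M‖ ^ 3 * ‖X‖ ^ 2 := by
  obtain ⟨C, hC0, hC⟩ := exists_interaction φ x
  refine ⟨C, hC0, fun K hK hKb ρ hρ M X => ?_⟩
  obtain ⟨hd, hd'⟩ := hKb M X
  have hr : domainNorm ⟨_, hd⟩ ≤ ρ * ‖M‖ * ‖X‖ := hd'.trans (by gcongr)
  obtain ⟨e, he, he'⟩ := exists_mem_ballEnergies φ x hC0 (hC M) ⟨hd, hr⟩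
  have hlow : ∀ e ∈ ballEnergies φ x M (ρ * ‖M‖) X, _ ≤ e :=
    fun e he => le_of_mem_ballEnergies φ x hC0 (hC M) he
  have hglb : IsGLB (ballEnergies φ x M (ρ * ‖M‖) X) (infEnergy φ x M (ρ * ‖M‖) X) :=
    isGLB_csInf ⟨e, he⟩ ⟨_, hlow⟩
  refine ⟨hglb, ?_⟩
  have h1 := hglb.1 he
  have h2 := hglb.2 hlow
  have h3 : energyForm φ x X M
      = -(inner ℂ (interactionVacuum φ x M X) (explicitCorrector φ x M X)).re := rfl
  have h4 : C * ‖M‖ * (ρ * ‖M‖) ^ 2 * ‖X‖ ^ 2 = C * ρ ^ 2 * ‖M‖ ^ 3 * ‖X‖ ^ 2 := by ring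
  rw [h4] at h2 he'
  rw [h3, abs_le]
  constructor <;> linarith

end

end SpinPhoton

end

open SpinPhoton
theorem proposition2p1 (P : ℕ) (x : Fin P → EuclideanSpace ℝ (Fin 3)) (φ : 𝓢(ℝ, ℂ)) :
    (∀ M, (hamiltonian φ x M).domain = (freeHamiltonian P).domain) ∧
    (∀ M X, AOpDefined φ x M X) ∧
    (∃ K : ℝ, 0 < K ∧ IsCorrectorBound φ x K) ∧
    (∃ C : ℝ, 0 < C ∧ ∀ K : ℝ, 0 < K → IsCorrectorBound φ x K →
      ∀ ρ : ℝ, K ≤ ρ → ∀ M : EuclideanSpace ℝ (Fin P), ‖M‖ < 1 / ρ → ∀ X : Hsp P,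
        IsGLB (ballEnergies φ x M (ρ * ‖M‖) X) (infEnergy φ x M (ρ * ‖M‖) X) ∧
        ‖inner ℂ (AOp φ x M X) X - (infEnergy φ x M (ρ * ‖M‖) X : ℂ)‖
          ≤ C * ρ ^ 2 * ‖M‖ ^ 3 * ‖X‖ ^ 2) ∧
    (∀ X : Hsp P, ∃ Q : QuadraticForm ℝ (EuclideanSpace ℝ (Fin P)),
      (∀ M, (Q M : ℂ) = inner ℂ (AOp φ x M X) X) ∧
      ∀ K : ℝ, 0 < K → IsCorrectorBound φ x K → ∀ ρ : ℝ, K ≤ ρ →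
        (fun M => infEnergy φ x M (ρ * ‖M‖) X - Q M) =O[𝓝 0] fun M => ‖M‖ ^ 3) := by
  obtain ⟨C, hC0, hC⟩ := exists_energy_bound φ x
  refine ⟨hamiltonian_domain φ x, aOpDefined φ x, exists_isCorrectorBound φ x,
    ⟨C, hC0, fun K hK hKb ρ hρ M _ X => ?_⟩,
    fun X => ⟨energyForm φ x X, fun M => energyForm_eq φ x M X, fun K hK hKb ρ hρ => ?_⟩⟩
  · obtain ⟨h1, h2⟩ := hC K hK hKb ρ hρ M X
    refine ⟨h1, ?_⟩
    rw [← energyForm_eq, ← Complex.ofReal_sub, Complex.norm_real, Real.norm_eq_abs, abs_sub_comm]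
    exact h2
  · refine Asymptotics.IsBigO.of_bound (C * ρ ^ 2 * ‖X‖ ^ 2) (Eventually.of_forall fun M => ?_)
    rw [Real.norm_eq_abs, norm_pow, norm_norm, mul_right_comm]
    exact (hC K hK hKb ρ hρ M X).2
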